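/- Let $A$ be a finite set, $n\ge 0$, and $R\subseteq A^{2n+1}$, written $R(y_0,\dots,y_n,x_1,\dots,x_n)$. **Parameterized relations and q-definability.** A parameter $\mathbf z=(z_a)_{a\in A}\in A^{A}$ assigns an element $z_a\in A$ to every $a\in A$. A $\mathbf z$-parameterized unary relation $D$ is a subset of $A^{A}\times A$, with ${}^{\mathbf z}D=\{d:(\mathbf z,d)\in D\}$; a $(\mathbf z,\alpha)$-parameterized binary relation $Q$, with $\alpha\in A^m$, $m\ge 1$, is a subset of $A^{A}\times A^m\times A^2$, with ${}^{\mathbf z}Q^{\alpha}=\{(a,b):(\mathbf z,\alpha,a,b)\in Q\}$. Put ${}^{\mathbf z}Q^{\forall}=\bigcap_{x\in A}{}^{\mathbf z}Q^{(x,\dots,x)}$ and ${}^{\mathbf z}Q^{\forall\forall}=\bigcap_{\alpha\in A^m}{}^{\mathbf z}Q^{\alpha}$. For $U\subseteq A$ and $S\subseteq A^2$ put $U+S=\{x:\exists c\in U,\ (c,x)\in S\}$. A relation is q-definable from $R$ if it is defined by a formula built from atoms $R(v_1,\dots,v_{2n+1})$ using only $\wedge$, $\exists$ and $\forall$ (not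 all free variables need to occur); parameterized relations are regarded as relations of arity $|A|+1$ and $|A|+m+2$, respectively. **Induced instance.** For $0\le m\le n-1$ let $$\mathcal S_R^m(y_0,\dots,y_m,x_1,\dots,x_m)=\forall x\,\exists y_{m+1}\,\forall x'\,\exists y_{m+2}\dots\exists y_n\; R(y_0,\dots,y_n,x_1,\dots,x_m,x,x',\dots,x'),$$ and let $\mathcal S_R^n=R$. The induced $\mathbf z$-parameterized CSP instance $\mathcal I_R$ has the variables $y_m^{a_1,\dots,a_m}$ for $0\le m\le n$ and $a_1,\dots,a_m\in A$, and is the conjunction $$\mathcal I_R=\bigwedge_{0\le m\le n,\ a_1,\dots,a_m\in A}\mathcal S_R^m\bigl(y_0,y_1^{a_1},\dots,y_m^{a_1,\dots,a_m},z_{a_1},\dots,z_{a_m}\bigr).$$ A $\mathbf z$-parameterized reduction $D$ assigns to each variable $u$ a $\mathbf z$-parameterized unary relation $D_u$. It is nonempty if ${}^{\mathbf z}D_u\neq\varnothing$ for all $u$ and $\mathbf z$. It is 1-consistent if for every $\mathbf z$, every constraint $C$ of $\mathcal I_R$ and every variable $u$ of $C$, the set of values taken by $u$ in the tuples that satisfy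 $C$ at $\mathbf z$ and have the value of each variable $v$ of $C$ in ${}^{\mathbf z}D_v$ is exactly ${}^{\mathbf z}D_u$. **Mighty tuples.** $(Q,D,B,C)$, where $Q$ is a $(\mathbf z,\alpha)$-parameterized binary relation and $D,B,C$ are $\mathbf z$-parameterized unary relations, is a *mighty tuple IV* if for every $\mathbf z$: $\varnothing\ne{}^{\mathbf z}B\subseteq{}^{\mathbf z}D$, $\varnothing\neq{}^{\mathbf z}C\subseteq{}^{\mathbf z}D$, ${}^{\mathbf z}B+{}^{\mathbf z}Q^{\forall\forall}={}^{\mathbf z}B$, ${}^{\mathbf z}B+{}^{\mathbf z}Q^{\forall}={}^{\mathbf z}D$, ${}^{\mathbf z}D+{}^{\mathbf z}Q^{\forall\forall}={}^{\mathbf z}D$; and ${}^{\mathbf z}B\cap{}^{\mathbf z}C=\varnothing$ for some $\mathbf z$. $(Q,D)$ is a *mighty tuple V* if for every $\mathbf z$: ${}^{\mathbf z}D\neq\varnothing$, $(d,d)\in{}^{\mathbf z}Q^{\forall}$ for all $d\in{}^{\mathbf z}D$, and both coordinate projections of ${}^{\mathbf z}Q^{\forall\forall}$ equal ${}^{\mathbf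 z}D$; and, for some $\mathbf z$, ${}^{\mathbf z}Q^{\forall\forall}$ contains no pair $(d,d)$ with $d\in A$. **Theorem.** Suppose that there exists a nonempty 1-consistent $\mathbf z$-parameterized reduction for $\mathcal I_R$. Then at least one of the following holds: 1. $\mathcal I_R$ has a solution for every $\mathbf z\in A^{A}$; 2. there exists a mighty tuple IV or a mighty tuple V all of whose relations are q-definable from $R$. -/

import Mathlib

namespace QCSP

universe u v

/-- A constraint language on `A`: a set of relations on `A` of arbitrary finite arities. -/
abbrev ConstraintLanguage (A : Type u) := Set (Σ k : ℕ, Set (Fin k → A))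

/-- Quantified conjunctive formulas over `Γ` with free variables in `V` (not every variable
of `V` has to occur): built from atoms `P(v₁,…,v_k)` with `P ∈ Γ` by conjunction and by
existential and universal quantification. In `ex φ` and `all φ` the bound variable is
`none : Option V`. Equality is not available as an atom unless it belongs to `Γ`. -/
inductive QCFormula {A : Type u} (Γ : ConstraintLanguage A) : Type v → Type (max u (v + 1))
  | atom {V : Type v} (k : ℕ) (P : Set (Fin k → A)) (hP : ⟨k, P⟩ ∈ Γ) (w : Fin k → V) :
      QCFormula Γ V
  | and {V : Type v} (φ ψ : QCFormula Γ V) : QCFormula Γ V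
  | ex {V : Type v} (φ : QCFormula Γ (Option V)) : QCFormula Γ V
  | all {V : Type v} (φ : QCFormula Γ (Option V)) : QCFormula Γ V

/-- Truth of a formula in `A` under the assignment `s` of its free variables. -/
def QCFormula.Holds {A : Type u} {Γ : ConstraintLanguage A} :
    {V : Type v} → QCFormula Γ V → (V → A) → Prop
  | _, .atom _ P _ w, s => (fun i => s (w i)) ∈ P
  | _, .and φ ψ, s => φ.Holds s ∧ ψ.Holds s
  | _, .ex φ, s => ∃ b : A, φ.Holds (fun o => o.elim b s)
  | _, .all φ, s => ∀ b : A, φ.Holds (fun o => o.elim b s)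

/-- `Γ` q-defines the relation `S`, whose coordinates are indexed by `V`. -/
def QDefines {A : Type u} (Γ : ConstraintLanguage A) {V : Type v} (S : Set (V → A)) : Prop :=
  ∃ φ : QCFormula Γ V, ∀ s : V → A, s ∈ S ↔ φ.Holds s

/-! ### Parameterized relations

The parameter `𝐳 ∈ A^{|A|}` is a function `z : A → A`; its coordinate `z_a` is `z a`. -/

/-- A `𝐳`-parameterized unary relation. -/
abbrev ZUnary (A : Type u) := (A → A) → Set A

/-- A `(𝐳,α)`-parameterized binary relation with `α ∈ A^m`. -/
abbrev ZABinary (A : Type u) (m : ℕ) := (A → A) → (Fin m → A) → A → A → Prop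

/-- The relation of arity `|A| + 1` underlying a `𝐳`-parameterized unary relation. -/
def ZUnary.toRel {A : Type u} (D : ZUnary A) : Set (A ⊕ Fin 1 → A) :=
  {v | v (.inr 0) ∈ D (fun a => v (.inl a))}

/-- The relation of arity `|A| + m + 2` underlying a `(𝐳,α)`-parameterized binary relation. -/
def ZABinary.toRel {A : Type u} {m : ℕ} (Q : ZABinary A m) :
    Set (A ⊕ (Fin m ⊕ Fin 2) → A) :=
  {v | Q (fun a => v (.inl a)) (fun i => v (.inr (.inl i)))
    (v (.inr (.inr 0))) (v (.inr (.inr 1)))}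

/-- `Q^∀`: all coordinates of `α` are replaced by one universally quantified variable. -/
def ZABinary.forall₁ {A : Type u} {m : ℕ} (Q : ZABinary A m) (z : A → A) (y₁ y₂ : A) : Prop :=
  ∀ x : A, Q z (fun _ => x) y₁ y₂

/-- `Q^{∀∀}`: the coordinates of `α` are universally quantified independently. -/
def ZABinary.forall₂ {A : Type u} {m : ℕ} (Q : ZABinary A m) (z : A → A) (y₁ y₂ : A) : Prop :=
  ∀ α : Fin m → A, Q z α y₁ y₂

/-- `U + S` for unary `U` and binary `S`. -/
def plus {A : Type u} (U : Set A) (S : A → A → Prop) : Set A :=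
  {x | ∃ c, c ∈ U ∧ S c x}

/-! ### Mighty tuples -/

structure IsMightyTupleIV {A : Type u} {m : ℕ} (Q : ZABinary A m) (D B C : ZUnary A) :
    Prop where
  nonempty_B : ∀ z, (B z).Nonempty
  B_subset : ∀ z, B z ⊆ D z
  nonempty_C : ∀ z, (C z).Nonempty
  C_subset : ∀ z, C z ⊆ D z
  B_stable : ∀ z, plus (B z) (Q.forall₂ z) = B z
  B_spreads : ∀ z, plus (B z) (Q.forall₁ z) = D z
  D_stable : ∀ z, plus (D z) (Q.forall₂ z) = D z
  disjoint : ∃ z, B z ∩ C z = ∅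

structure IsMightyTupleV {A : Type u} {m : ℕ} (Q : ZABinary A m) (D : ZUnary A) : Prop where
  nonempty : ∀ z, (D z).Nonempty
  reflexive : ∀ z, ∀ d ∈ D z, Q.forall₁ z d d
  proj_one : ∀ z, {d | ∃ e, Q.forall₂ z d e} = D z
  proj_two : ∀ z, {e | ∃ d, Q.forall₂ z d e} = D z
  irreflexive : ∃ z, ∀ d : A, ¬ Q.forall₂ z d d

/-- There is a mighty tuple IV all of whose relations are q-definable over `Γ`. -/
def QDefinesMightyTupleIV {A : Type u} (Γ : ConstraintLanguage A) : Prop :=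
  ∃ (m : ℕ) (Q : ZABinary A m) (D B C : ZUnary A), 1 ≤ m ∧ IsMightyTupleIV Q D B C ∧
    QDefines Γ Q.toRel ∧ QDefines Γ D.toRel ∧ QDefines Γ B.toRel ∧ QDefines Γ C.toRel

/-- There is a mighty tuple V both of whose relations are q-definable over `Γ`. -/
def QDefinesMightyTupleV {A : Type u} (Γ : ConstraintLanguage A) : Prop :=
  ∃ (m : ℕ) (Q : ZABinary A m) (D : ZUnary A), 1 ≤ m ∧ IsMightyTupleV Q D ∧
    QDefines Γ Q.toRel ∧ QDefines Γ D.toRel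

/-! ### `𝐳`-parameterized CSP instances and reductions -/

/-- A `𝐳`-parameterized constraint `R(u₁,…,u_s)` with variables from `V`. -/
structure ZConstraint (A : Type u) (V : Type v) where
  arity : ℕ
  rel : (A → A) → Set (Fin arity → A)
  scope : Fin arity → V

/-- A `𝐳`-parameterized CSP instance: the conjunction of a set of constraints. -/
abbrev ZInstance (A : Type u) (V : Type v) := Set (ZConstraint A V)

/-- `s` is a solution of the instance `I` for the parameter value `z`. -/
def ZInstance.IsSolution {A : Type u} {V : Type v} (I : ZInstance A V) (z : A → A)
    (s : V → A) : Prop :=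
  ∀ c ∈ I, (fun i => s (c.scope i)) ∈ c.rel z

/-- A `𝐳`-parameterized reduction: a `𝐳`-parameterized unary relation for every variable. -/
abbrev ZReduction (A : Type u) (V : Type v) := V → ZUnary A

/-- Every `D_u` is nonempty for every value of the parameter `z`. -/
def ZReduction.IsNonempty {A : Type u} {V : Type v} (D : ZReduction A V) : Prop :=
  ∀ (x : V) (z : A → A), (D x z).Nonempty

/-- The relation of the constraint `c` after restricting its variables to `D`. -/
def ZConstraint.reducedRel {A : Type u} {V : Type v} (c : ZConstraint A V)
    (D : ZReduction A V) (z : A → A) : Set (Fin c.arity → A) :=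
  {t | t ∈ c.rel z ∧ ∀ i, t i ∈ D (c.scope i) z}

/-- `D` is 1-consistent for `I`: every reduced constraint projects onto `D_u` at each of its
variables `u`. -/
def ZReduction.IsOneConsistent {A : Type u} {V : Type v} (D : ZReduction A V)
    (I : ZInstance A V) : Prop :=
  ∀ c ∈ I, ∀ (i : Fin c.arity) (z : A → A),
    (fun t : Fin c.arity → A => t i) '' c.reducedRel D z = D (c.scope i) z

/-! ### The induced instance -/

/-- The relation `𝒮_R^m(y_0,…,y_m,x_1,…,x_m)`, for `R ⊆ A^{2n+1}` with coordinates ordered as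
`y_0,…,y_n,x_1,…,x_n` and `m ≤ n`:
`∀ x ∃ y_{m+1} ∀ x' ∃ y_{m+2} … ∃ y_n R(y_0,…,y_n,x_1,…,x_m,x,x',…,x')`.
Here `y'` is the completed tuple `(y_0,…,y_n)`, and `b` is the value of `y_{m+1}`, which has to
be chosen before `x'`. The coordinate `x_{j+1}` has index `j`. For `m = n` this is `R` itself,
see `sRel_self`. -/
def sRel {A : Type u} {n : ℕ} (R : Set (Fin (n + 1 + n) → A)) (m : ℕ) (hm : m < n + 1)
    (y : Fin (m + 1) → A) (x : Fin m → A) : Prop :=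
  ∀ c : A, ∃ b : A, ∀ c' : A, ∃ y' : Fin (n + 1) → A,
    (∀ i : Fin (m + 1), y' (Fin.castLE hm i) = y i) ∧
    (∀ h : m + 1 < n + 1, y' ⟨m + 1, h⟩ = b) ∧
    Fin.append y' (fun j : Fin n =>
      if h : (j : ℕ) < m then x ⟨j, h⟩ else if (j : ℕ) = m then c else c') ∈ R

theorem sRel_self {A : Type u} {n : ℕ} (R : Set (Fin (n + 1 + n) → A))
    (y : Fin (n + 1) → A) (x : Fin n → A) :
    sRel R n (Nat.lt_succ_self n) y x ↔ Fin.append y x ∈ R := by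
  constructor
  · intro h
    obtain ⟨b, hb⟩ := h (y 0)
    obtain ⟨y', h1, -, h3⟩ := hb (y 0)
    have hy : y' = y := funext h1
    simpa [hy] using h3
  · intro h c
    refine ⟨c, fun c' => ⟨y, fun i => rfl, fun hlt => absurd hlt (lt_irrefl _), ?_⟩⟩
    simpa using h

/-- The variables `y_m^{a_1,…,a_m}`, `0 ≤ m ≤ n`, of the induced instance. -/
abbrev YVar (A : Type u) (n : ℕ) := Σ m : Fin (n + 1), (Fin m → A)

/-- The constraint
`𝒮_R^m(y_0, y_1^{a_1}, …, y_m^{a_1,…,a_m}, z_{a_1}, …, z_{a_m})`. -/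
def inducedConstraint {A : Type u} {n : ℕ} (R : Set (Fin (n + 1 + n) → A))
    (p : YVar A n) : ZConstraint A (YVar A n) where
  arity := p.1 + 1
  rel := fun z => {t | sRel R p.1 p.1.2 t (fun i => z (p.2 i))}
  scope := fun i => ⟨Fin.castLE p.1.2 i, fun j => p.2 (Fin.castLE (Nat.le_of_lt_succ i.2) j)⟩

/-- The induced instance `ℐ_R`: one constraint for every `m ≤ n` and `a_1,…,a_m ∈ A`. -/
def inducedInstance {A : Type u} {n : ℕ} (R : Set (Fin (n + 1 + n) → A)) :
    ZInstance A (YVar A n) :=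
  Set.range (inducedConstraint R)

end QCSP

/-! Index the variables by words of length at most `n`. `Good R j z E` says that `E` is a nonempty
arc-consistent family for the instance in which all constraints at words shorter than `j` are merged
into one. A 1-consistent reduction gives `j = 1`, and `j = n + 1` gives a solution, so it suffices
to pass from `j` to `j + 1` in the absence of mighty tuples (`good_succ`).

Arc-consistency follows from solvability of all tree-like patterns (`exists_consistent`). In a
pattern for `j + 1`, give each word of length `j` in a merged constraint private copies of the
shorter variables. The result decomposes into constraints for `j`, so every short value extends to a
solution (`PhaseSetup.full_empty`). The copies are then glued back one at a time
(`PhaseSetup.full`). The tool is a parameter `α` through which universally quantified values are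
routed: `α = id` is the true relation, while constant `α` collapses the remaining universal
variables to one value. A solution for `id` at level `l` becomes one for every constant `α` at level
`l + 1`, with the same short values (`Solves.relax`). Hence the relation `Q` between a variable and
its copy has reflexive `Q^∀`, and without a mighty tuple V it has a loop in `Q^∀∀`: the glued
pattern is solvable. Its values at a short variable form a set that grows to the whole domain for
constant `α`; without a mighty tuple IV it is the whole domain already (`Critical.full`).

The last point uses domains chosen minimal among q-definable ones, so that each proper part `B` of a
domain `D` is refuted by a pattern. Suppose `X` is a proper family growing to `D`. Following the
moves `X ↦ X + S` leads to a terminal strongly connected component. There, a relation with `X + S^∀∀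
= X` and `X + S^∀ = D` would give a mighty tuple IV. Otherwise the relations keeping `X` proper
compose and yield a proper `B ⊇ X` closed under the reflexive ones. The relations between leaves of
a minimal refutation of `B` that keep `X` proper form an acyclic graph, and a leaf without incoming
edges stays free when all others are restricted to `X`. This solves the supposedly refuted pattern
(`Terminal.false`). -/

namespace QCSP

universe u

/-! ### Closure properties of q-definability -/

section Definability
variable {A : Type u} {Γ : ConstraintLanguage A}

/-- A predicate on assignments is q-definable over `Γ`. -/
def QDef (Γ : ConstraintLanguage A) {V : Type u} (S : (V → A) → Prop) : Prop :=
  QDefines Γ {s : V → A | S s}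

theorem QDef.congr {V : Type u} {S T : (V → A) → Prop} (h : QDef Γ S) (e : ∀ s, T s ↔ S s) :
    QDef Γ T := by
  obtain ⟨φ, hφ⟩ := h
  exact ⟨φ, fun s => (e s).trans (hφ s)⟩

theorem QCFormula.exists_rename {V : Type u} (φ : QCFormula Γ V) :
    ∀ {W : Type u} (g : V → W), ∃ ψ : QCFormula Γ W, ∀ s : W → A,
      ψ.Holds s ↔ φ.Holds (fun v => s (g v)) := by
  induction φ with
  | atom k P hP w => exact fun g => ⟨.atom k P hP (fun i => g (w i)), fun s => Iff.rfl⟩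
  | and φ ψ ih₁ ih₂ =>
    intro W g
    obtain ⟨φ', h₁⟩ := ih₁ g
    obtain ⟨ψ', h₂⟩ := ih₂ g
    exact ⟨.and φ' ψ', fun s => and_congr (h₁ s) (h₂ s)⟩
  | ex φ ih =>
    intro W g
    obtain ⟨φ', h⟩ := ih (Option.map g)
    refine ⟨.ex φ', fun s => exists_congr fun b => (h _).trans ?_⟩
    have : (fun v => (Option.map g v).elim b s) = fun o => Option.elim o b (fun v => s (g v)) := by
      funext o; cases o <;> rfl
    simp only [this]
  | all φ ih =>
    intro W g
    obtain ⟨φ', h⟩ := ih (Option.map g)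
    refine ⟨.all φ', fun s => forall_congr' fun b => (h _).trans ?_⟩
    have : (fun v => (Option.map g v).elim b s) = fun o => Option.elim o b (fun v => s (g v)) := by
      funext o; cases o <;> rfl
    simp only [this]

theorem QDef.comp {V W : Type u} {S : (V → A) → Prop} (h : QDef Γ S) (g : V → W) :
    QDef Γ (fun s : W → A => S (fun v => s (g v))) := by
  obtain ⟨φ, hφ⟩ := h
  obtain ⟨ψ, hψ⟩ := φ.exists_rename g
  exact ⟨ψ, fun s => (hφ _).trans (hψ s).symm⟩

theorem QDef.and {V : Type u} {S T : (V → A) → Prop} (hS : QDef Γ S) (hT : QDef Γ T) :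
    QDef Γ (fun s => S s ∧ T s) := by
  obtain ⟨φ, hφ⟩ := hS
  obtain ⟨ψ, hψ⟩ := hT
  exact ⟨.and φ ψ, fun s => and_congr (hφ s) (hψ s)⟩

theorem QDef.ex_option {V : Type u} {S : (Option V → A) → Prop} (h : QDef Γ S) :
    QDef Γ (fun s : V → A => ∃ b : A, S (fun o => o.elim b s)) := by
  obtain ⟨φ, hφ⟩ := h
  exact ⟨.ex φ, fun s => exists_congr fun b => hφ _⟩

theorem QDef.all_option {V : Type u} {S : (Option V → A) → Prop} (h : QDef Γ S) :
    QDef Γ (fun s : V → A => ∀ b : A, S (fun o => o.elim b s)) := by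
  obtain ⟨φ, hφ⟩ := h
  exact ⟨.all φ, fun s => forall_congr' fun b => hφ _⟩

theorem QDef.ex_sum {ι : Type u} [Finite ι] : ∀ {V : Type u} {S : (V ⊕ ι → A) → Prop},
    QDef Γ S → QDef Γ (fun s : V → A => ∃ g : ι → A, S (Sum.elim s g)) := by
  refine Finite.induction_empty_option (P := fun ι => ∀ {V : Type u} {S : (V ⊕ ι → A) → Prop},
    QDef Γ S → QDef Γ (fun s : V → A => ∃ g : ι → A, S (Sum.elim s g))) ?_ ?_ ?_ ι
  · intro ι κ e ih V S hS
    refine (ih (hS.comp (Sum.map id e.symm))).congr fun s => ?_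
    have key : ∀ g : ι → A, (fun v : V ⊕ κ => Sum.elim s g (Sum.map id e.symm v)) =
        Sum.elim s (fun k => g (e.symm k)) := fun g => by
      funext v; cases v <;> rfl
    constructor
    · rintro ⟨g, hg⟩
      refine ⟨fun i => g (e i), ?_⟩
      rw [key]; simpa using hg
    · rintro ⟨g, hg⟩
      rw [key] at hg
      exact ⟨_, hg⟩
  · intro V S hS
    refine (hS.comp (Sum.elim id PEmpty.elim)).congr fun s => ?_
    have key : ∀ g : PEmpty → A,
        (fun v : V ⊕ PEmpty => s (Sum.elim id PEmpty.elim v)) = Sum.elim s g := fun g => by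
      funext v; rcases v with v | v
      · rfl
      · exact v.elim
    exact ⟨fun ⟨g, hg⟩ => by rwa [key g], fun h => ⟨PEmpty.elim, by rwa [← key]⟩⟩
  · intro ι _ ih V S hS
    have h₁ := hS.comp (W := Option V ⊕ ι)
      (Sum.elim (fun v => .inl (some v)) (fun o => o.elim (.inl none) .inr))
    refine (QDef.ex_option (ih h₁)).congr fun s => ?_
    have key : ∀ (b : A) (g : ι → A), (fun v : V ⊕ Option ι =>
        Sum.elim (fun o : Option V => o.elim b s) g
          (Sum.elim (fun v => .inl (some v)) (fun o => o.elim (.inl none) .inr) v)) =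
        Sum.elim s (fun o => o.elim b g) := fun b g => by
      funext v; rcases v with v | (_ | v) <;> rfl
    constructor
    · rintro ⟨g, hg⟩
      refine ⟨g none, fun i => g (some i), ?_⟩
      rw [key]
      convert hg using 2
      funext o; cases o <;> rfl
    · rintro ⟨b, g, hg⟩
      rw [key] at hg
      exact ⟨_, hg⟩

theorem QDef.all_sum {ι : Type u} [Finite ι] : ∀ {V : Type u} {S : (V ⊕ ι → A) → Prop},
    QDef Γ S → QDef Γ (fun s : V → A => ∀ g : ι → A, S (Sum.elim s g)) := by
  refine Finite.induction_empty_option (P := fun ι => ∀ {V : Type u} {S : (V ⊕ ι → A) → Prop},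
    QDef Γ S → QDef Γ (fun s : V → A => ∀ g : ι → A, S (Sum.elim s g))) ?_ ?_ ?_ ι
  · intro ι κ e ih V S hS
    refine (ih (hS.comp (Sum.map id e.symm))).congr fun s => ?_
    have key : ∀ g : ι → A, (fun v : V ⊕ κ => Sum.elim s g (Sum.map id e.symm v)) =
        Sum.elim s (fun k => g (e.symm k)) := fun g => by
      funext v; cases v <;> rfl
    constructor
    · intro h g
      rw [key]; exact h _
    · intro h g
      have := h (fun i => g (e i))
      rw [key] at this; simpa using this
  · intro V S hS
    refine (hS.comp (Sum.elim id PEmpty.elim)).congr fun s => ?_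
    have key : ∀ g : PEmpty → A,
        (fun v : V ⊕ PEmpty => s (Sum.elim id PEmpty.elim v)) = Sum.elim s g := fun g => by
      funext v; rcases v with v | v
      · rfl
      · exact v.elim
    exact ⟨fun h => by rw [key PEmpty.elim]; exact h _, fun h g => by rwa [← key]⟩
  · intro ι _ ih V S hS
    have h₁ := hS.comp (W := Option V ⊕ ι)
      (Sum.elim (fun v => .inl (some v)) (fun o => o.elim (.inl none) .inr))
    refine (QDef.all_option (ih h₁)).congr fun s => ?_
    have key : ∀ (b : A) (g : ι → A), (fun v : V ⊕ Option ι =>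
        Sum.elim (fun o : Option V => o.elim b s) g
          (Sum.elim (fun v => .inl (some v)) (fun o => o.elim (.inl none) .inr) v)) =
        Sum.elim s (fun o => o.elim b g) := fun b g => by
      funext v; rcases v with v | (_ | v) <;> rfl
    constructor
    · intro h b g
      rw [key]; exact h _
    · intro h g
      have := h (g none) (fun i => g (some i))
      rw [key] at this
      convert this using 2
      funext o; cases o <;> rfl

theorem QDef.exists_fun {ι V : Type u} [Finite ι] {P : (V → A) → (ι → A) → Prop}
    (h : QDef Γ (fun f : V ⊕ ι → A => P (fun v => f (.inl v)) (fun i => f (.inr i)))) :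
    QDef Γ (fun s : V → A => ∃ g : ι → A, P s g) :=
  (QDef.ex_sum h).congr fun _ => Iff.rfl

theorem QDef.forall_fun {ι V : Type u} [Finite ι] {P : (V → A) → (ι → A) → Prop}
    (h : QDef Γ (fun f : V ⊕ ι → A => P (fun v => f (.inl v)) (fun i => f (.inr i)))) :
    QDef Γ (fun s : V → A => ∀ g : ι → A, P s g) :=
  (QDef.all_sum h).congr fun _ => Iff.rfl

theorem QDef.exists_elem {V : Type u} {P : (V → A) → A → Prop}
    (h : QDef Γ (fun f : Option V → A => P (fun v => f (some v)) (f none))) :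
    QDef Γ (fun s : V → A => ∃ b, P s b) :=
  (QDef.ex_option h).congr fun _ => Iff.rfl

theorem QDef.forall_elem {V : Type u} {P : (V → A) → A → Prop}
    (h : QDef Γ (fun f : Option V → A => P (fun v => f (some v)) (f none))) :
    QDef Γ (fun s : V → A => ∀ b, P s b) :=
  (QDef.all_option h).congr fun _ => Iff.rfl

theorem QDef.atom {V : Type u} {k : ℕ} {P : Set (Fin k → A)} (hP : ⟨k, P⟩ ∈ Γ) (w : Fin k → V) :
    QDef Γ (fun s : V → A => (fun i => s (w i)) ∈ P) :=
  ⟨.atom k P hP w, fun _ => Iff.rfl⟩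

/-- Some relation of the language is nonempty. -/
def HasNonempty (Γ : ConstraintLanguage A) : Prop :=
  ∃ (k : ℕ) (P : Set (Fin k → A)), ⟨k, P⟩ ∈ Γ ∧ P.Nonempty

/-- Formulas have no truth constant; the assertion that some relation of the language is nonempty
serves as one. Empty conjunctions rely on it. -/
theorem QDef.true (hΓ : HasNonempty Γ) {V : Type u} : QDef Γ (fun _ : V → A => True) := by
  obtain ⟨k, P, hP, t, ht⟩ := hΓ
  refine (QDef.exists_fun (ι := ULift.{u} (Fin k)) (V := V) (P := fun _ g => (fun i => g ⟨i⟩) ∈ P)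
    (QDef.atom hP fun i => (Sum.inr (ULift.up i) : V ⊕ ULift.{u} (Fin k)))).congr fun s => ?_
  exact ⟨fun _ => ⟨fun i => t i.down, ht⟩, fun _ => trivial⟩

theorem QDef.imp (hΓ : HasNonempty Γ) {V : Type u} {p : Prop} {S : (V → A) → Prop}
    (h : p → QDef Γ S) : QDef Γ (fun s => p → S s) := by
  by_cases hp : p
  · exact (h hp).congr fun s => ⟨fun h => h hp, fun h _ => h⟩
  · exact (QDef.true hΓ).congr fun s => ⟨fun _ => trivial, fun _ h => absurd h hp⟩

theorem QDef.forall_index (hΓ : HasNonempty Γ) {ι : Type*} [Finite ι] {V : Type u} :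
    ∀ {S : ι → (V → A) → Prop}, (∀ i, QDef Γ (S i)) → QDef Γ (fun s => ∀ i, S i s) := by
  refine Finite.induction_empty_option (P := fun ι => ∀ {S : ι → (V → A) → Prop},
    (∀ i, QDef Γ (S i)) → QDef Γ (fun s => ∀ i, S i s)) ?_ ?_ ?_ ι
  · intro ι κ e ih S hS
    refine (ih (S := fun i => S (e i)) fun i => hS _).congr fun s => ?_
    exact ⟨fun h i => h _, fun h i => by simpa using h (e.symm i)⟩
  · intro S _
    exact (QDef.true hΓ).congr fun s => ⟨fun _ => trivial, fun _ i => i.elim⟩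
  · intro ι _ ih S hS
    exact ((hS none).and (ih fun i => hS (some i))).congr fun s => Option.forall

end Definability

/-! ### Smooth, linked and spreading parameterized relations -/

section Relations
variable {A : Type u} {Γ : ConstraintLanguage A}

/-- Equality is not an atom, so a pinned coordinate is handled by substituting the free variable for
it. This is why each coordinate may be pinned to at most one variable. -/
theorem QDef.exists_pinned {V X : Type u} [Finite V] {P : (X → A) → (V → A) → Prop}
    (hP : QDef Γ fun f : X ⊕ V → A => P (fun x => f (Sum.inl x)) (fun v => f (Sum.inr v)))
    (p : V → Option X) :
    QDef Γ fun s : X → A => ∃ h, P s h ∧ ∀ v x, p v = some x → h v = s x := by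
  refine (QDef.exists_fun (ι := V) (V := X) (P := fun s h => P s fun v => (p v).elim (h v) s)
    ((hP.comp (W := X ⊕ V) (Sum.elim Sum.inl fun v => (p v).elim (Sum.inr v) Sum.inl)).congr
      fun s => ?_)).congr fun s => ?_
  · have : (fun v => s (Sum.elim Sum.inl (fun v => (p v).elim (Sum.inr v) Sum.inl) (Sum.inr v)))
        = fun v => (p v).elim (s (Sum.inr v)) fun x => s (Sum.inl x) := by
      funext v
      simp only [Sum.elim_inr]
      cases p v <;> rfl
    rw [this]
    rfl
  · constructor
    · rintro ⟨h, h₁, h₂⟩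
      refine ⟨h, ?_⟩
      convert h₁ using 1
      funext v
      cases hv : p v with
      | none => rfl
      | some x => exact (h₂ v x hv).symm
    · rintro ⟨h, h₁⟩
      exact ⟨_, h₁, fun v x hv => by simp [hv]⟩

/-- A `(𝐳,α)`-parameterized binary relation whose parameter `α` is indexed by `A`. -/
abbrev ARel (A : Type u) := (A → A) → (A → A) → A → A → Prop

/-- A `(𝐳,α)`-parameterized unary relation whose parameter `α` is indexed by `A`. -/
abbrev ASet (A : Type u) := (A → A) → (A → A) → Set A

/-- A `(𝐳,α)`-parameterized relation with coordinates in `V`. -/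
abbrev ATup (A : Type u) (V : Type u) := (A → A) → (A → A) → (V → A) → Prop

def ARel.comp (S T : ARel A) : ARel A := fun z α c d => ∃ e, S z α c e ∧ T z α e d
def ARel.inv (S : ARel A) : ARel A := fun z α c d => S z α d c
/-- The relation `S^∀`. -/
def ARel.cst (S : ARel A) (z : A → A) (c d : A) : Prop := ∀ x, S z (fun _ => x) c d
def ASet.add (X : ASet A) (S : ARel A) : ASet A := fun z α => plus (X z α) (S z α)

/-- Variables may be placed arbitrarily and with repetitions, so constant `α` is obtained by sending
all its coordinates to one variable. -/
def ARel.Def (Γ : ConstraintLanguage A) (S : ARel A) : Prop :=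
  ∀ ⦃X : Type u⦄ (zf αf : A → X) (x y : X),
    QDef Γ fun s => S (fun a => s (zf a)) (fun a => s (αf a)) (s x) (s y)

def ASet.Def (Γ : ConstraintLanguage A) (Y : ASet A) : Prop :=
  ∀ ⦃X : Type u⦄ (zf αf : A → X) (x : X),
    QDef Γ fun s => s x ∈ Y (fun a => s (zf a)) (fun a => s (αf a))

def ATup.Def (Γ : ConstraintLanguage A) {V : Type u} (Θ : ATup A V) : Prop :=
  ∀ ⦃X : Type u⦄ (zf αf : A → X) (g : V → X),
    QDef Γ fun s => Θ (fun a => s (zf a)) (fun a => s (αf a)) (fun v => s (g v))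

def ZUnary.Def (Γ : ConstraintLanguage A) (B : ZUnary A) : Prop :=
  ∀ ⦃X : Type u⦄ (zf : A → X) (x : X), QDef Γ fun s => s x ∈ B (fun a => s (zf a))

/-- q-definable, monotone and subdirect in `D × D` for `α = id`. -/
structure Smooth (Γ : ConstraintLanguage A) (D : ZUnary A) (S : ARel A) : Prop where
  defn : ARel.Def Γ S
  mono : ∀ z α c d, S z id c d → S z α c d
  left : ∀ z α c d, S z α c d → c ∈ D z
  right : ∀ z α c d, S z α c d → d ∈ D z
  ltot : ∀ z, ∀ c ∈ D z, ∃ d, S z id c d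
  rtot : ∀ z, ∀ d ∈ D z, ∃ c, S z id c d

/-- A q-definable monotone family of subsets of `D` that grows to `D` at constant `α`. -/
structure Spread (Γ : ConstraintLanguage A) (D : ZUnary A) (X : ASet A) : Prop where
  defn : ASet.Def Γ X
  mono : ∀ z α, X z id ⊆ X z α
  sub : ∀ z α, X z α ⊆ D z
  nonempty : ∀ z, (X z id).Nonempty
  const : ∀ z x, D z ⊆ X z fun _ => x

/-- Relations that become reflexive after repeatedly passing to `S^∀`. -/
inductive Linked (Γ : ConstraintLanguage A) (D : ZUnary A) : ARel A → Prop
  | refl {S : ARel A} (hS : Smooth Γ D S) (h : ∀ z, ∀ d ∈ D z, S.cst z d d) : Linked Γ D S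
  | step {S S' : ARel A} (hS : Smooth Γ D S) (hS' : Linked Γ D S')
      (h : ∀ z c d, S' z id c d → S.cst z c d) : Linked Γ D S

/-- The projection of `Θ` to the coordinates `a` and `b`. -/
def ATup.pair {V : Type u} (Θ : ATup A V) (a b : V) : ARel A :=
  fun z α c d => ∃ h, Θ z α h ∧ h a = c ∧ h b = d

/-- A q-definable tree-like relation witnessing that `B` is not a reduction of `D`. -/
structure Detects (Γ : ConstraintLanguage A) (D B : ZUnary A) {V : Type u} (ι : Finset V)
    (Θ : ATup A V) : Prop where
  defn : ATup.Def Γ Θ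
  mono : ∀ z α h, Θ z id h → Θ z α h
  mem : ∀ z α h, Θ z α h → ∀ a ∈ ι, h a ∈ D z
  nonempty : ∀ z, ∃ h, Θ z id h
  smooth : ∀ z, ∀ a ∈ ι, ∀ d ∈ D z, ∃ h, Θ z id h ∧ h a = d
  linked : ∀ a ∈ ι, ∀ b ∈ ι, a ≠ b → Linked Γ D (Θ.pair a b)
  unsat : ∃ z, ¬ ∃ h, Θ z id h ∧ ∀ a ∈ ι, h a ∈ B z

/-- Every q-definable proper part of `D` is detected. -/
def Critical (Γ : ConstraintLanguage A) (D : ZUnary A) : Prop :=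
  ∀ B : ZUnary A, ZUnary.Def Γ B → (∀ z, (B z).Nonempty) → (∀ z, B z ⊆ D z) →
    (∃ z, B z ≠ D z) → ∃ (V : Type u) (_ : Finite V) (ι : Finset V) (Θ : ATup A V),
      Detects Γ D B ι Θ

variable {D : ZUnary A} {S T : ARel A} {X : ASet A}

theorem Smooth.comp (hS : Smooth Γ D S) (hT : Smooth Γ D T) : Smooth Γ D (S.comp T) where
  defn := fun _ zf αf x y => QDef.exists_elem
    ((hS.defn (fun a => some (zf a)) (fun a => some (αf a)) (some x) none).and
      (hT.defn (fun a => some (zf a)) (fun a => some (αf a)) none (some y)))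
  mono := fun z α c d ⟨e, h₁, h₂⟩ => ⟨e, hS.mono _ _ _ _ h₁, hT.mono _ _ _ _ h₂⟩
  left := fun z α c d ⟨e, h₁, _⟩ => hS.left _ _ _ _ h₁
  right := fun z α c d ⟨e, _, h₂⟩ => hT.right _ _ _ _ h₂
  ltot := fun z c hc => by
    obtain ⟨e, he⟩ := hS.ltot z c hc
    obtain ⟨d, hd⟩ := hT.ltot z e (hS.right _ _ _ _ he)
    exact ⟨d, e, he, hd⟩
  rtot := fun z d hd => by
    obtain ⟨e, he⟩ := hT.rtot z d hd
    obtain ⟨c, hc⟩ := hS.rtot z e (hT.left _ _ _ _ he)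
    exact ⟨c, e, hc, he⟩

theorem Smooth.inv (hS : Smooth Γ D S) : Smooth Γ D S.inv where
  defn := fun _ zf αf x y => hS.defn zf αf y x
  mono := fun _ _ _ _ h => hS.mono _ _ _ _ h
  left := fun _ _ _ _ h => hS.right _ _ _ _ h
  right := fun _ _ _ _ h => hS.left _ _ _ _ h
  ltot := hS.rtot
  rtot := hS.ltot

theorem Smooth.cst_of_id (hS : Smooth Γ D S) {z : A → A} {c d : A} (h : S z id c d) :
    S.cst z c d := fun _ => hS.mono _ _ _ _ h

theorem Smooth.cst_right [Nonempty A] (hS : Smooth Γ D S) {z : A → A} {c d : A}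
    (h : S.cst z c d) : d ∈ D z := hS.right _ _ _ _ (h (Classical.arbitrary A))

theorem ARel.cst_comp {z : A → A} {c e d : A} (h₁ : S.cst z c e) (h₂ : T.cst z e d) :
    (S.comp T).cst z c d := fun x => ⟨e, h₁ x, h₂ x⟩

theorem Linked.smooth (h : Linked Γ D S) : Smooth Γ D S := by
  cases h <;> assumption

/-- First run down the chain of `S` with `T` kept fixed; once `S^∀` is reflexive, `S` can be dropped
and the chain of `T` continues. -/
theorem Linked.comp (hS : Linked Γ D S) (hT : Linked Γ D T) : Linked Γ D (S.comp T) := by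
  induction hS with
  | refl hS h =>
    exact .step (hS.comp hT.smooth) hT fun z c d hcd =>
      ARel.cst_comp (h z c (hT.smooth.left _ _ _ _ hcd)) (hT.smooth.cst_of_id hcd)
  | step hS _ h ih =>
    exact .step (hS.comp hT.smooth) ih fun z c d ⟨e, h₁, h₂⟩ =>
      ARel.cst_comp (h z c e h₁) (hT.smooth.cst_of_id h₂)

theorem Linked.inv (hS : Linked Γ D S) : Linked Γ D S.inv := by
  induction hS with
  | refl hS h => exact .refl hS.inv fun z d hd => h z d hd
  | step hS _ h ih => exact .step hS.inv ih fun z c d hcd => h z d c hcd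

theorem Spread.add (hX : Spread Γ D X) (hS : Smooth Γ D S) : Spread Γ D (X.add S) where
  defn := fun _ zf αf x => QDef.exists_elem
    ((hX.defn (fun a => some (zf a)) (fun a => some (αf a)) none).and
      (hS.defn (fun a => some (zf a)) (fun a => some (αf a)) none (some x)))
  mono := fun z α d ⟨c, h₁, h₂⟩ => ⟨c, hX.mono _ _ h₁, hS.mono _ _ _ _ h₂⟩
  sub := fun z α d ⟨c, _, h₂⟩ => hS.right _ _ _ _ h₂
  nonempty := fun z => by
    obtain ⟨c, hc⟩ := hX.nonempty z
    obtain ⟨d, hd⟩ := hS.ltot z c (hX.sub _ _ hc)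
    exact ⟨d, c, hc, hd⟩
  const := fun z x d hd => by
    obtain ⟨c, hc⟩ := hS.rtot z d hd
    exact ⟨c, hX.const _ _ (hS.left _ _ _ _ hc), hS.mono _ _ _ _ hc⟩

theorem ASet.add_comp (X : ASet A) (S T : ARel A) : X.add (S.comp T) = (X.add S).add T := by
  funext z α
  ext d
  constructor
  · rintro ⟨c, hc, e, h₁, h₂⟩
    exact ⟨e, ⟨c, hc, h₁⟩, h₂⟩
  · rintro ⟨e, ⟨c, hc, h₁⟩, h₂⟩
    exact ⟨c, hc, e, h₁, h₂⟩

/-- `X` is a proper part of `D` for some value of `𝐳`. -/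
def Proper (D : ZUnary A) (X : ASet A) : Prop := ∃ z, ¬ D z ⊆ X z id

/-- The case `a = b` is excluded because the projection would be an equality relation, which need
not be q-definable. -/
theorem ATup.pair_smooth {V : Type u} [Finite V] {Θ : ATup A V} {a b : V}
    (hd : ATup.Def Γ Θ) (hm : ∀ z α h, Θ z id h → Θ z α h)
    (hma : ∀ z α h, Θ z α h → h a ∈ D z) (hmb : ∀ z α h, Θ z α h → h b ∈ D z)
    (hsa : ∀ z, ∀ d ∈ D z, ∃ h, Θ z id h ∧ h a = d)
    (hsb : ∀ z, ∀ d ∈ D z, ∃ h, Θ z id h ∧ h b = d) (hab : a ≠ b) :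
    Smooth Γ D (Θ.pair a b) where
  defn := by
    classical
    intro Y zf αf x y
    refine (QDef.exists_pinned (P := fun s h => Θ (fun a => s (zf a)) (fun a => s (αf a)) h)
      (hd (fun a => Sum.inl (zf a)) (fun a => Sum.inl (αf a)) Sum.inr)
      (fun v => if v = a then some x else if v = b then some y else none)).congr fun s => ?_
    refine exists_congr fun h => and_congr_right fun _ => ?_
    constructor
    · rintro ⟨h₁, h₂⟩ v w hv
      split_ifs at hv with h₃ h₄
      · simp_all
      · simp_all
    · intro H
      exact ⟨H a x (by simp), H b y (by simp [hab.symm])⟩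
  mono := fun z α c d ⟨h, h₁, h₂⟩ => ⟨h, hm _ _ _ h₁, h₂⟩
  left := fun z α c d ⟨h, h₁, h₂, _⟩ => h₂ ▸ hma _ _ _ h₁
  right := fun z α c d ⟨h, h₁, _, h₂⟩ => h₂ ▸ hmb _ _ _ h₁
  ltot := fun z c hc => by
    obtain ⟨h, h₁, h₂⟩ := hsa z c hc
    exact ⟨h b, h, h₁, h₂, rfl⟩
  rtot := fun z c hc => by
    obtain ⟨h, h₁, h₂⟩ := hsb z c hc
    exact ⟨h a, h, h₁, rfl, h₂⟩

end Relations

/-! ### Producing mighty tuples -/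

section Mighty
variable {A : Type u} [Finite A] [Nonempty A] {Γ : ConstraintLanguage A} {D : ZUnary A}
  {S T : ARel A} {X : ASet A}

theorem ZUnary.Def.toRel {B : ZUnary A} (h : ZUnary.Def Γ B) : QDefines Γ B.toRel :=
  h (X := A ⊕ Fin 1) Sum.inl (Sum.inr 0)

/-- Enumerate `A` and reindex `α`. For a monotone `S` the value `α = id` is the most restrictive
one, so it computes `S^∀∀`. -/
theorem exists_toRel_ARel (A : Type u) [Finite A] [Nonempty A] :
    ∃ (m : ℕ), 1 ≤ m ∧ ∃ f : ARel A → ZABinary A m, ∀ (Γ : ConstraintLanguage A) (S : ARel A),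
      (ARel.Def Γ S → QDefines Γ (f S).toRel) ∧
      (∀ z c d, (f S).forall₁ z c d ↔ S.cst z c d) ∧
      ((∀ z α c d, S z id c d → S z α c d) → ∀ z c d, (f S).forall₂ z c d ↔ S z id c d) := by
  obtain ⟨m, ⟨e⟩⟩ := Finite.exists_equiv_fin A
  refine ⟨m, ?_, fun S z α => S z fun a => α (e a), fun Γ S => ⟨fun h => ?_, fun z c d => ?_,
    fun h z c d => ⟨fun H => ?_, fun H α => h _ _ _ _ H⟩⟩⟩
  · exact Nat.one_le_iff_ne_zero.2 fun h => by
      subst h; exact (e (Classical.arbitrary A)).elim0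
  · exact h (X := A ⊕ (Fin m ⊕ Fin 2)) Sum.inl (fun a => Sum.inr (Sum.inl (e a))) (Sum.inr (Sum.inr 0))
      (Sum.inr (Sum.inr 1))
  · exact Iff.rfl
  · have := H e.symm
    simpa [Function.id_def] using this

/-- Restricting the leaves in `J` except one to `B` gives a set disjoint from `B`. -/
theorem exists_disjoint_of_critical {B : ZUnary A} (hΓ : HasNonempty Γ) (hcrit : Critical Γ D)
    (hB : ZUnary.Def Γ B) (hne : ∀ z, (B z).Nonempty) (hsub : ∀ z, B z ⊆ D z)
    (hprop : ∃ z, B z ≠ D z) :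
    ∃ C : ZUnary A, ZUnary.Def Γ C ∧ (∀ z, (C z).Nonempty) ∧ (∀ z, C z ⊆ D z) ∧
      ∃ z, B z ∩ C z = ∅ := by
  classical
  obtain ⟨V, _, ι, Θ, hΘ⟩ := hcrit B hB hne hsub hprop
  obtain ⟨J, hJ⟩ := exists_minimal_of_wellFoundedLT
    (fun J : Finset V => J ⊆ ι ∧ ∃ z, ¬ ∃ h, Θ z id h ∧ ∀ a ∈ J, h a ∈ B z)
    ⟨ι, subset_rfl, hΘ.unsat⟩
  obtain ⟨⟨hJι, z₀, hz₀⟩, hmin⟩ := hJ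
  obtain ⟨j, hj⟩ : J.Nonempty := by
    rw [Finset.nonempty_iff_ne_empty]
    rintro rfl
    obtain ⟨h, hh⟩ := hΘ.nonempty z₀
    exact hz₀ ⟨h, hh, by simp⟩
  -- `J` is minimal among leaf sets failing for some parameter, so after deleting `j` the
  -- restriction is satisfiable for every `z`.
  have hdel : ∀ z, ∃ h, Θ z id h ∧ ∀ a ∈ J.erase j, h a ∈ B z := by
    by_contra! hcon
    obtain ⟨z, hz⟩ := hcon
    have := hmin (y := J.erase j) ⟨(Finset.erase_subset _ _).trans hJι, z, by
      push Not; exact hz⟩ (Finset.erase_subset _ _)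
    exact absurd (this hj) (by simp)
  -- Quantifying over all `α` expresses `α = id` by a formula, by monotonicity.
  refine ⟨fun z => {d | ∃ h, (∀ α, Θ z α h) ∧ (∀ a ∈ J.erase j, h a ∈ B z) ∧ h j = d},
    ?_, ?_, ?_, z₀, ?_⟩
  · intro Y zf x
    refine (QDef.exists_pinned (P := fun s h => (∀ α, Θ (fun a => s (zf a)) α h) ∧
        ∀ a : V, a ∈ J.erase j → h a ∈ B fun a => s (zf a)) (QDef.and
        (QDef.forall_fun (ι := A) (V := Y ⊕ V)
          (P := fun s α => Θ (fun a => s (Sum.inl (zf a))) α fun v => s (Sum.inr v))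
          (hΘ.defn (fun a => Sum.inl (Sum.inl (zf a))) Sum.inr fun v => Sum.inl (Sum.inr v)))
        (QDef.forall_index hΓ fun a => QDef.imp hΓ fun _ =>
          hB (fun a => Sum.inl (zf a)) (Sum.inr a)))
      (fun v => if v = j then some x else none)).congr fun s => ?_
    refine exists_congr fun h => ?_
    simp [and_assoc]
  · intro z
    obtain ⟨h, h₁, h₂⟩ := hdel z
    exact ⟨h j, h, fun α => hΘ.mono _ _ _ h₁, h₂, rfl⟩
  · rintro z _ ⟨h, h₁, -, rfl⟩
    exact hΘ.mem z _ _ (h₁ id) j (hJι hj)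
  · ext d
    simp only [Set.mem_inter_iff, Set.mem_empty_iff_false, iff_false]
    rintro ⟨hd, h, h₁, h₂, rfl⟩
    refine hz₀ ⟨h, h₁ id, fun a ha => ?_⟩
    by_cases haj : a = j
    · exact haj ▸ hd
    · exact h₂ a (Finset.mem_erase.2 ⟨haj, ha⟩)

theorem Spread.id_def (hX : Spread Γ D X) : ZUnary.Def Γ (fun z => X z id) := by
  intro Y zf x
  refine (QDef.forall_fun (ι := A) (V := Y)
    (P := fun s α => s x ∈ X (fun a => s (zf a)) α)
    (hX.defn (fun a => Sum.inl (zf a)) Sum.inr (Sum.inl x))).congr fun s => ?_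
  exact ⟨fun h α => hX.mono _ _ h, fun h => h id⟩

/-- Take `B = X` at `id` and `Q = S`. The set `C` comes from a refutation of `B`. -/
theorem mightyTupleIV_of_spreads (hΓ : HasNonempty Γ) (hcrit : Critical Γ D) (hD : ZUnary.Def Γ D)
    (hX : Spread Γ D X) (hprop : Proper D X) (hS : Smooth Γ D S)
    (hstable : ∀ z, plus (X z id) (S z id) = X z id)
    (hspread : ∀ z, D z ⊆ plus (X z id) (S.cst z)) : QDefinesMightyTupleIV Γ := by
  obtain ⟨m, hm, f, hf⟩ := exists_toRel_ARel A
  obtain ⟨h₁, h₂, h₃⟩ := hf Γ S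
  obtain ⟨C, hC, hCne, hCsub, hdisj⟩ := exists_disjoint_of_critical hΓ hcrit hX.id_def hX.nonempty
    (fun z => hX.sub z id) (hprop.imp fun z h h' => h h'.ge)
  have h₄ : ∀ z, (f S).forall₂ z = S z id := fun z => by
    funext c d; exact propext (h₃ hS.mono z c d)
  have h₅ : ∀ z, (f S).forall₁ z = S.cst z := fun z => by
    funext c d; exact propext (h₂ z c d)
  refine ⟨m, f S, D, fun z => X z id, C, hm, ⟨hX.nonempty, fun z => hX.sub z id, hCne, hCsub,
    fun z => by rw [h₄, hstable], fun z => ?_, fun z => ?_, hdisj⟩, h₁ hS.defn, hD.toRel,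
    hX.id_def.toRel, hC.toRel⟩
  · rw [h₅]
    refine Set.Subset.antisymm ?_ (hspread z)
    rintro d ⟨c, _, h⟩
    exact hS.cst_right h
  · rw [h₄]
    refine Set.Subset.antisymm (fun d ⟨c, _, h⟩ => hS.right _ _ _ _ h) fun d hd => ?_
    obtain ⟨c, hc⟩ := hS.rtot z d hd
    exact ⟨c, hS.left _ _ _ _ hc, hc⟩

theorem exists_loop_of_not_mightyTupleV (hV : ¬ QDefinesMightyTupleV Γ) (hD : ZUnary.Def Γ D)
    (hne : ∀ z, (D z).Nonempty) (hS : Smooth Γ D S) (hrefl : ∀ z, ∀ d ∈ D z, S.cst z d d)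
    (z : A → A) : ∃ d, S z id d d := by
  by_contra! hcon
  obtain ⟨m, hm, f, hf⟩ := exists_toRel_ARel A
  obtain ⟨h₁, h₂, h₃⟩ := hf Γ S
  replace h₃ := h₃ hS.mono
  refine hV ⟨m, f S, D, hm, ⟨hne, fun z d hd => (h₂ _ _ _).2 (hrefl z d hd), fun z => ?_,
    fun z => ?_, z, fun d => by rw [h₃]; exact hcon d⟩, h₁ hS.defn, hD.toRel⟩
  · ext d
    simp only [h₃]
    exact ⟨fun ⟨e, h⟩ => hS.left _ _ _ _ h, hS.ltot z d⟩
  · ext d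
    simp only [h₃]
    exact ⟨fun ⟨e, h⟩ => hS.right _ _ _ _ h, hS.rtot z d⟩

end Mighty

/-! ### Critical domains have no proper spreading family -/

section Atomic
variable {A : Type u} [Finite A] [Nonempty A] {Γ : ConstraintLanguage A} {D : ZUnary A}
  {S T : ARel A} {X : ASet A}

/-- If no leaf in `K` is related to `j`, restricting the leaves in `K` to `X` leaves the leaf
`j` free. -/
theorem Detects.full_of_initial (hΓ : HasNonempty Γ) {B : ZUnary A} {V : Type u} [Finite V]
    {ι J : Finset V} {Θ : ATup A V} (hΘ : Detects Γ D B ι Θ) (hX : Spread Γ D X) (hJ : J ⊆ ι)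
    (E : V → V → Prop)
    (hE : ∀ i ∈ J, ∀ j ∈ J, i ≠ j → ∀ S, Linked Γ D S →
      (∀ z c d, Θ.pair i j z id c d → S.cst z c d) → Proper D (X.add S) → E i j)
    (hinit : ∀ K ⊆ J, K.Nonempty → ∃ i ∈ K, ∀ i' ∈ K, i' ≠ i → ¬ E i' i) :
    ∀ (n : ℕ) (K : Finset V), K.card = n → K ⊆ J → ∀ j ∈ J, j ∉ K → (∀ i ∈ K, ¬ E i j) →
      ∀ z, ∀ d ∈ D z, ∃ h, Θ z id h ∧ (∀ k ∈ K, h k ∈ X z id) ∧ h j = d := by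
  classical
  intro n
  induction n with
  | zero =>
    intro K hK _ j hj _ _ z d hd
    obtain rfl := Finset.card_eq_zero.1 hK
    obtain ⟨h, h₁, h₂⟩ := hΘ.smooth z j (hJ hj) d hd
    exact ⟨h, h₁, by simp, h₂⟩
  | succ n ih =>
    intro K hKn hK j hj hjK hEj z d hd
    obtain ⟨i, hi, hini⟩ := hinit K hK (Finset.card_pos.1 (by omega))
    have hcard : (K.erase i).card = n := by rw [Finset.card_erase_of_mem hi]; omega
    have hsub : K.erase i ⊆ J := (Finset.erase_subset _ _).trans hK
    have hij : i ≠ j := fun h => hjK (h ▸ hi)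
    -- Restrict all leaves of `K` except `i` to `X`. By induction both `i` and `j` remain free, so
    -- the projection of `Θ'` to them is smooth.
    let Θ' : ATup A V := fun z α h => Θ z α h ∧ ∀ k, k ∈ K.erase i → h k ∈ X z α
    have hS : Smooth Γ D (Θ'.pair i j) := by
      refine ATup.pair_smooth (Θ := Θ') ?_ ?_ ?_ ?_ ?_ ?_ hij
      · intro Y zf αf g
        exact (hΘ.defn zf αf g).and (QDef.forall_index hΓ fun k => QDef.imp hΓ fun _ =>
          hX.defn zf αf (g k))
      · exact fun z α h hh => ⟨hΘ.mono _ _ _ hh.1, fun k hk => hX.mono _ _ (hh.2 k hk)⟩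
      · exact fun z α h hh => hΘ.mem z α h hh.1 i (hJ (hK hi))
      · exact fun z α h hh => hΘ.mem z α h hh.1 j (hJ hj)
      · intro z d hd
        obtain ⟨h, h₁, h₂, h₃⟩ := ih _ hcard hsub i (hK hi) (Finset.notMem_erase _ _)
          (fun i' hi' => hini i' (Finset.mem_of_mem_erase hi') (Finset.ne_of_mem_erase hi')) z d hd
        exact ⟨h, ⟨h₁, h₂⟩, h₃⟩
      · intro z d hd
        obtain ⟨h, h₁, h₂, h₃⟩ := ih _ hcard hsub j hj
          (fun h => hjK (Finset.mem_of_mem_erase h))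
          (fun i' hi' => hEj i' (Finset.mem_of_mem_erase hi')) z d hd
        exact ⟨h, ⟨h₁, h₂⟩, h₃⟩
    -- For constant `α` the family `X` is all of `D`, so the restrictions in `Θ'` are void.
    have hcst : ∀ z c d, Θ.pair i j z id c d → (Θ'.pair i j).cst z c d := by
      rintro z c d ⟨h, h₁, h₂⟩ x
      exact ⟨h, ⟨hΘ.mono _ _ _ h₁, fun k hk => hX.const z x
        (hΘ.mem z _ h h₁ k (hJ (hsub hk)))⟩, h₂⟩
    have hlink : Linked Γ D (Θ'.pair i j) :=
      .step hS (hΘ.linked i (hJ (hK hi)) j (hJ hj) hij) hcst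
    by_contra hcon
    refine hEj i hi (hE i (hK hi) j hj hij _ hlink hcst ⟨z, fun hfull => ?_⟩)
    obtain ⟨c, hc, h, ⟨h₁, h₂⟩, rfl, hd'⟩ := hfull hd
    refine hcon ⟨h, h₁, fun k hk => ?_, hd'⟩
    by_cases hki : k = i
    · exact hki ▸ hc
    · exact h₂ k (Finset.mem_erase.2 ⟨hki, hk⟩)

variable (Γ D) in
/-- One step in the graph of proper families. -/
def Edge (X Y : ASet A) : Prop := ∃ S, Linked Γ D S ∧ Y = X.add S ∧ Proper D Y

theorem Edge.trans {X Y Z : ASet A} (h₁ : Edge Γ D X Y) (h₂ : Edge Γ D Y Z) : Edge Γ D X Z := by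
  obtain ⟨S, hS, rfl, -⟩ := h₁
  obtain ⟨T, hT, rfl, hp⟩ := h₂
  exact ⟨S.comp T, hS.comp hT, (X.add_comp S T).symm, (X.add_comp S T) ▸ hp⟩

/-- If every move from `X` filled `D`, one leaf of a refutation of `X` would be free while the
others lie in `X`; a value in `X` there contradicts the refutation. -/
theorem Critical.exists_edge (hΓ : HasNonempty Γ) (hcrit : Critical Γ D) (hX : Spread Γ D X)
    (hprop : Proper D X) : ∃ Y, Edge Γ D X Y := by
  classical
  by_contra! hno
  obtain ⟨V, _, ι, Θ, hΘ⟩ := hcrit _ hX.id_def hX.nonempty (fun z => hX.sub z id)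
    (hprop.imp fun z h h' => h h'.ge)
  obtain ⟨z, hz⟩ := hΘ.unsat
  obtain ⟨j, hj⟩ : ι.Nonempty := by
    rw [Finset.nonempty_iff_ne_empty]
    rintro rfl
    obtain ⟨h, hh⟩ := hΘ.nonempty z
    exact hz ⟨h, hh, by simp⟩
  obtain ⟨d, hd⟩ := hX.nonempty z
  obtain ⟨h, h₁, h₂, h₃⟩ := hΘ.full_of_initial hΓ hX subset_rfl (fun _ _ => False)
    (fun i _ j _ _ S hS _ hp => hno _ ⟨S, hS, rfl, hp⟩)
    (fun K _ ⟨i, hi⟩ => ⟨i, hi, by simp⟩) _ (ι.erase j) rfl (Finset.erase_subset _ _) j hj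
    (by simp) (by simp) z d (hX.sub _ _ hd)
  refine hz ⟨h, h₁, fun a ha => ?_⟩
  by_cases haj : a = j
  · rw [haj, h₃]; exact hd
  · exact h₂ a (Finset.mem_erase.2 ⟨haj, ha⟩)

/-- A vertex in a terminal strongly connected component. -/
theorem Critical.exists_terminal (hΓ : HasNonempty Γ) (hcrit : Critical Γ D) (hX : Spread Γ D X)
    (hprop : Proper D X) : ∃ X₀, Spread Γ D X₀ ∧ Edge Γ D X₀ X₀ ∧
      ∀ Y, Edge Γ D X₀ Y → Edge Γ D Y X₀ := by
  have key : ∀ {Y Z}, Spread Γ D Y → Edge Γ D Y Z → Spread Γ D Z := by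
    rintro Y _ hY ⟨S, hS, rfl, -⟩
    exact hY.add hS.smooth
  -- A vertex with a minimal set of successors: by transitivity each of its successors has the same
  -- successor set.
  obtain ⟨O, ⟨Y, hY, hYp, rfl⟩, hmin⟩ := exists_minimal_of_wellFoundedLT
    (fun O : Set (ASet A) => ∃ Y, Spread Γ D Y ∧ Proper D Y ∧ O = {Z | Edge Γ D Y Z})
    ⟨_, X, hX, hprop, rfl⟩
  have hstep : ∀ Z, Edge Γ D Y Z → ∀ Z', Edge Γ D Y Z' → Edge Γ D Z Z' := by
    intro Z hZ Z' hZ'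
    have hZp : Proper D Z := by obtain ⟨_, _, _, h⟩ := hZ; exact h
    exact hmin (y := {Z' | Edge Γ D Z Z'}) ⟨Z, key hY hZ, hZp, rfl⟩
      (fun _ h => hZ.trans h) hZ'
  obtain ⟨Z, hZ⟩ := hcrit.exists_edge hΓ hY hYp
  exact ⟨Z, key hY hZ, hstep Z hZ Z hZ, fun W hW => hstep W (hZ.trans hW) Z hZ⟩

/-- Data at a terminal vertex in the absence of mighty tuples IV. -/
structure Terminal (Γ : ConstraintLanguage A) (D : ZUnary A) (X : ASet A) : Prop where
  spread : Spread Γ D X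
  loop : Edge Γ D X X
  back : ∀ Y, Edge Γ D X Y → Edge Γ D Y X
  not_spreads : ∀ S, Smooth Γ D S → (∀ z, plus (X z id) (S z id) = X z id) →
    ∃ z, ¬ D z ⊆ plus (X z id) (S.cst z)

variable (Γ D) in
def Keeps (X : ASet A) (P : ARel A) : Prop := Linked Γ D P ∧ Proper D (X.add P)

/-- If `X + P^∀` were `D`, composing `P` with a relation `R` leading from `X + P` back to `X` would
give a relation that fixes `X` and still spreads it to `D`. -/
theorem Terminal.proper_cst (hX : Terminal Γ D X) {P : ARel A} (hP : Keeps Γ D X P) :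
    ∃ z, ¬ D z ⊆ plus (X z id) (P.cst z) := by
  obtain ⟨R, hR, hXR, -⟩ := hX.back _ ⟨P, hP.1, rfl, hP.2⟩
  rw [← ASet.add_comp] at hXR
  obtain ⟨z, hz⟩ := hX.not_spreads (P.comp R) (hP.1.comp hR).smooth fun z =>
    (congrFun (congrFun hXR z) id).symm
  refine ⟨z, fun h => hz fun d hd => ?_⟩
  obtain ⟨e, he⟩ := hR.smooth.rtot z d hd
  obtain ⟨c, hc, hce⟩ := h (hR.smooth.left _ _ _ _ he)
  exact ⟨c, hc, ARel.cst_comp hce (hR.smooth.cst_of_id he)⟩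

theorem Terminal.keeps_of_le (hX : Terminal Γ D X) {P P' : ARel A} (hP : Keeps Γ D X P)
    (hP' : Linked Γ D P') (hle : ∀ z c d, P' z id c d → P.cst z c d) : Keeps Γ D X P' := by
  refine ⟨hP', ?_⟩
  obtain ⟨z, hz⟩ := hX.proper_cst hP
  exact ⟨z, fun h => hz (h.trans fun d ⟨c, hc, hcd⟩ => ⟨c, hc, hle _ _ _ hcd⟩)⟩

/-- Insert between `P` and `Q` a relation `R` returning from `X + P` to `X`. Then replace `R` by the
successive members of its chain until it is reflexive and can be removed. -/
theorem Terminal.keeps_comp (hX : Terminal Γ D X) {P Q : ARel A} (hP : Keeps Γ D X P)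
    (hQ : Keeps Γ D X Q) : Keeps Γ D X (P.comp Q) := by
  obtain ⟨R, hR, hXR, -⟩ := hX.back _ ⟨P, hP.1, rfl, hP.2⟩
  have h₁ : Keeps Γ D X (P.comp (R.comp Q)) := by
    refine ⟨hP.1.comp (hR.comp hQ.1), ?_⟩
    rw [ASet.add_comp, ASet.add_comp, ← hXR]
    exact hQ.2
  clear hXR
  induction hR with
  | refl hR h =>
    refine hX.keeps_of_le h₁ (hP.1.comp hQ.1) fun z c d ⟨e, h₂, h₃⟩ => ?_
    exact ARel.cst_comp (hP.1.smooth.cst_of_id h₂)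
      (ARel.cst_comp (h z e (hP.1.smooth.right _ _ _ _ h₂)) (hQ.1.smooth.cst_of_id h₃))
  | step hR hR' h ih =>
    refine ih (hX.keeps_of_le h₁ (hP.1.comp (hR'.comp hQ.1)) fun z c d ⟨e, h₂, e', h₃, h₄⟩ => ?_)
    exact ARel.cst_comp (hP.1.smooth.cst_of_id h₂)
      (ARel.cst_comp (h _ _ _ h₃) (hQ.1.smooth.cst_of_id h₄))

variable (Γ D) in
/-- Members of `Keeps` with reflexive `P^∀`. -/
def KeepsRefl (X : ASet A) (P : ARel A) : Prop :=
  Keeps Γ D X P ∧ ∀ z, ∀ d ∈ D z, P.cst z d d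

theorem Terminal.exists_keepsRefl (hX : Terminal Γ D X) : ∃ P, KeepsRefl Γ D X P := by
  obtain ⟨S, hS, hXS, hp⟩ := hX.loop
  have h₁ : Keeps Γ D X S := ⟨hS, hXS ▸ hp⟩
  clear hXS
  induction hS with
  | refl hS h => exact ⟨_, h₁, h⟩
  | step hS hS' h ih => exact ih (hX.keeps_of_le h₁ hS' h)

/-- Induct along the chain of `S`, treating both directions at once: going out by `S^∀ ⊇ S'` and
returning by the relation found for the inverse of `S'` makes the composite reflexive. -/
theorem Terminal.exists_keepsRefl_ge (hX : Terminal Γ D X) (hS : Linked Γ D S)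
    (h₁ : Keeps Γ D X S) (h₂ : Keeps Γ D X S.inv) :
    (∃ P, KeepsRefl Γ D X P ∧ ∀ z c d, S z id c d → P.cst z c d) ∧
      ∃ P, KeepsRefl Γ D X P ∧ ∀ z c d, S z id d c → P.cst z c d := by
  induction hS with
  | refl hS h =>
    exact ⟨⟨_, ⟨h₁, h⟩, fun z c d => hS.cst_of_id⟩,
      ⟨_, ⟨h₂, fun z d hd => h z d hd⟩, fun z c d => hS.inv.cst_of_id⟩⟩
  | @step S S' hS hS' h ih =>
    obtain ⟨⟨P₁, hP₁, hle₁⟩, P₂, hP₂, hle₂⟩ := ih (hX.keeps_of_le h₁ hS' h)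
      (hX.keeps_of_le h₂ hS'.inv fun z c d => h z d c)
    refine ⟨⟨S.comp P₂, ⟨hX.keeps_comp h₁ hP₂.1, fun z d hd => ?_⟩, fun z c d hcd => ?_⟩,
      ⟨S.inv.comp P₁, ⟨hX.keeps_comp h₂ hP₁.1, fun z d hd => ?_⟩, fun z c d hcd => ?_⟩⟩
    · obtain ⟨e, he⟩ := hS'.smooth.ltot z d hd
      exact ARel.cst_comp (h _ _ _ he) (hle₂ _ _ _ he)
    · exact ARel.cst_comp (hS.cst_of_id hcd) (hP₂.2 z d (hS.right _ _ _ _ hcd))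
    · obtain ⟨e, he⟩ := hS'.smooth.rtot z d hd
      exact ARel.cst_comp (fun x => h _ _ _ he x) (hle₁ _ _ _ he)
    · exact ARel.cst_comp (hS.inv.cst_of_id hcd) (hP₁.2 z d (hS.left _ _ _ _ hcd))

/-- A q-definable proper part of `D` that contains `X` and is closed under `P^∀` for all `P` in
`KeepsRefl`. -/
theorem Terminal.exists_closed (hX : Terminal Γ D X) : ∃ B : ZUnary A, ZUnary.Def Γ B ∧
    (∀ z, X z id ⊆ B z) ∧ (∀ z, B z ⊆ D z) ∧ (∃ z, B z ≠ D z) ∧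
    ∀ P, KeepsRefl Γ D X P → ∀ z c d, c ∈ B z → P.cst z c d → d ∈ B z := by
  obtain ⟨P₀, hP₀⟩ := hX.exists_keepsRefl
  -- Composing `P` with a further reflexive relation can only enlarge `X + P^∀`, so a maximal such
  -- set is closed.
  obtain ⟨B, ⟨P, hP, rfl⟩, hmax⟩ := exists_maximal_of_wellFoundedGT
    (fun B : ZUnary A => ∃ P, KeepsRefl Γ D X P ∧ B = fun z => plus (X z id) (P.cst z))
    ⟨_, P₀, hP₀, rfl⟩
  refine ⟨fun z => plus (X z id) (P.cst z), ?_,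
    fun z d hd => ⟨d, hd, hP.2 z d (hX.spread.sub _ _ hd)⟩, ?_, ?_, fun Q hQ z c d hc hcd => ?_⟩
  · intro Y zf x
    refine QDef.exists_elem (QDef.and (hX.spread.id_def (fun a => some (zf a)) none) ?_)
    exact QDef.forall_elem (hP.1.1.smooth.defn (fun a => some (some (zf a))) (fun _ => none)
      (some none) (some (some x)))
  · rintro z d ⟨c, _, hc⟩
    exact hP.1.1.smooth.cst_right hc
  · obtain ⟨z, hz⟩ := hX.proper_cst hP.1
    exact ⟨z, fun h => hz h.ge⟩
  · obtain ⟨b, hb, hbc⟩ := hc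
    refine hmax (y := fun z => plus (X z id) ((P.comp Q).cst z))
      ⟨P.comp Q, ⟨hX.keeps_comp hP.1 hQ.1, fun z d hd =>
        ARel.cst_comp (hP.2 z d hd) (hQ.2 z d hd)⟩, rfl⟩ (fun z d ⟨c, hc, hcd⟩ => ?_) z
        ⟨b, hb, ARel.cst_comp hbc hcd⟩
    exact ⟨c, hc, ARel.cst_comp hcd (hQ.2 z d (hP.1.1.smooth.cst_right hcd))⟩

theorem Terminal.false (hΓ : HasNonempty Γ) (hcrit : Critical Γ D) (hX : Terminal Γ D X) :
    False := by
  classical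
  obtain ⟨B, hB, hXB, hBD, hBp, hBcl⟩ := hX.exists_closed
  obtain ⟨V, _, ι, Θ, hΘ⟩ := hcrit B hB (fun z => (hX.spread.nonempty z).mono (hXB z)) hBD hBp
  obtain ⟨J, ⟨hJι, z₀, hz₀⟩, hmin⟩ := exists_minimal_of_wellFoundedLT
    (fun J : Finset V => J ⊆ ι ∧ ∃ z, ¬ ∃ h, Θ z id h ∧ ∀ a ∈ J, h a ∈ B z)
    ⟨ι, subset_rfl, hΘ.unsat⟩
  have hdel : ∀ j ∈ J, ∀ z, ∃ h, Θ z id h ∧ ∀ a ∈ J.erase j, h a ∈ B z := by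
    intro j hj
    by_contra! hcon
    obtain ⟨z, hz⟩ := hcon
    have := hmin (y := J.erase j) ⟨(Finset.erase_subset _ _).trans hJι, z, by
      push Not; exact hz⟩ (Finset.erase_subset _ _)
    exact absurd (this hj) (by simp)
  let E : V → V → Prop := fun i j => i ≠ j ∧ Proper D (X.add (Θ.pair i j))
  have hlink : ∀ i ∈ J, ∀ j ∈ J, i ≠ j → Linked Γ D (Θ.pair i j) := fun i hi j hj =>
    hΘ.linked i (hJι hi) j (hJι hj)
  -- With edges both ways, some reflexive `P` has `P^∀` above the projection to `i` and `j`. Closure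
  -- of `B` then carries membership from leaf `i` to leaf `j`, so `j` would be redundant in the
  -- minimal set `J`.
  have hasymm : ∀ i ∈ J, ∀ j ∈ J, E i j → ¬ E j i := by
    intro i hi j hj hij hji
    have hinv : (Θ.pair i j).inv = Θ.pair j i := by
      funext z α c d
      exact propext ⟨fun ⟨h, h₁, h₂, h₃⟩ => ⟨h, h₁, h₃, h₂⟩, fun ⟨h, h₁, h₂, h₃⟩ => ⟨h, h₁, h₃, h₂⟩⟩
    have hl := hlink i hi j hj hij.1
    obtain ⟨⟨P, hP, hle⟩, -⟩ := hX.exists_keepsRefl_ge hl ⟨hl, hij.2⟩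
      ⟨hl.inv, hinv ▸ hji.2⟩
    obtain ⟨h, h₁, h₂⟩ := hdel j hj z₀
    refine hz₀ ⟨h, h₁, fun a ha => ?_⟩
    by_cases haj : a = j
    · subst haj
      exact hBcl P hP z₀ _ _ (h₂ i (Finset.mem_erase.2 ⟨hij.1, hi⟩)) (hle _ _ _ ⟨h, h₁, rfl, rfl⟩)
    · exact h₂ a (Finset.mem_erase.2 ⟨haj, ha⟩)
  have htrans : ∀ i ∈ J, ∀ j ∈ J, ∀ k ∈ J, E i j → E j k → E i k := by
    intro i hi j hj k hk hij hjk
    have hik : i ≠ k := fun h => hasymm i hi j hj hij (h ▸ hjk)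
    obtain ⟨-, z, hz⟩ := hX.keeps_comp ⟨hlink i hi j hj hij.1, hij.2⟩
      ⟨hlink j hj k hk hjk.1, hjk.2⟩
    refine ⟨hik, z, fun h => hz (h.trans ?_)⟩
    rintro d ⟨c, hc, h, h₁, h₂, h₃⟩
    exact ⟨c, hc, h j, ⟨h, h₁, h₂, rfl⟩, ⟨h, h₁, rfl, h₃⟩⟩
  have hinit : ∀ K ⊆ J, K.Nonempty → ∃ i ∈ K, ∀ i' ∈ K, i' ≠ i → ¬ E i' i := by
    rintro K hK ⟨i₀, hi₀⟩
    let r : K → K → Prop := fun a b => E a b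
    have : IsTrans K r := ⟨fun a b c => htrans a (hK a.2) b (hK b.2) c (hK c.2)⟩
    have : Std.Irrefl r := ⟨fun a h => h.1 rfl⟩
    obtain ⟨m, -, hm⟩ := (Finite.wellFounded_of_trans_of_irrefl r).has_min Set.univ
      ⟨⟨i₀, hi₀⟩, trivial⟩
    exact ⟨m, m.2, fun i' hi' _ => hm ⟨i', hi'⟩ trivial⟩
  obtain ⟨j, hj, hjinit⟩ := hinit J subset_rfl (by
    rw [Finset.nonempty_iff_ne_empty]
    rintro rfl
    obtain ⟨h, hh⟩ := hΘ.nonempty z₀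
    exact hz₀ ⟨h, hh, by simp⟩)
  obtain ⟨d, hd⟩ := hX.spread.nonempty z₀
  obtain ⟨h, h₁, h₂, h₃⟩ := hΘ.full_of_initial hΓ hX.spread hJι E
    (fun i hi j hj hij S hS hle hp => ⟨hij,
      (hX.keeps_of_le ⟨hS, hp⟩ (hlink i hi j hj hij) hle).2⟩) hinit _ (J.erase j) rfl
    (Finset.erase_subset _ _) j hj (by simp)
    (fun i hi => hjinit i (Finset.mem_of_mem_erase hi) (Finset.ne_of_mem_erase hi)) z₀ d
    (hX.spread.sub _ _ hd)
  refine hz₀ ⟨h, h₁, fun a ha => hXB _ ?_⟩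
  by_cases haj : a = j
  · rw [haj, h₃]; exact hd
  · exact h₂ a (Finset.mem_erase.2 ⟨haj, ha⟩)

/-- If there is no mighty tuple IV, then a critical `D` has no proper family. -/
theorem Critical.full (hΓ : HasNonempty Γ) (hIV : ¬ QDefinesMightyTupleIV Γ)
    (hD : ZUnary.Def Γ D) (hcrit : Critical Γ D) (hX : Spread Γ D X) (z : A → A) :
    D z ⊆ X z id := by
  by_contra hcon
  obtain ⟨X₀, h₁, h₂, h₃⟩ := hcrit.exists_terminal hΓ hX ⟨z, hcon⟩
  refine Terminal.false hΓ hcrit ⟨h₁, h₂, h₃, fun S hS hst => ?_⟩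
  by_contra! hsp
  obtain ⟨_, _, _, hp⟩ := h₂
  exact hIV (mightyTupleIV_of_spreads hΓ hcrit hD h₁ hp hS hst hsp)

end Atomic

/-! ### Tree-like patterns and arc-consistency -/

section Patterns
variable {κ W A S : Type u}

/-- Tree-like gluings of constraints of kinds `κ`, joined at coordinates from `W`. -/
inductive Pattern (κ W : Type u) : Type u
  | single (k : κ) : Pattern κ W
  | join (p q : Pattern κ W) (w : W) : Pattern κ W

def Pattern.Block : Pattern κ W → Type u
  | .single _ => PUnit
  | .join p q _ => p.Block ⊕ q.Block

instance Pattern.finite_block : ∀ p : Pattern κ W, Finite p.Block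
  | .single _ => inferInstanceAs (Finite PUnit)
  | .join p q _ =>
    have := finite_block p
    have := finite_block q
    inferInstanceAs (Finite (p.Block ⊕ q.Block))

def Pattern.root : (p : Pattern κ W) → p.Block
  | .single _ => PUnit.unit
  | .join p _ _ => .inl p.root

def Pattern.kind : (p : Pattern κ W) → p.Block → κ
  | .single k => fun _ => k
  | .join p q _ => Sum.elim p.kind q.kind

def Pattern.Valid (K : Set κ) (vis : κ → Set W) : Pattern κ W → Prop
  | .single k => k ∈ K
  | .join p q w => p.Valid K vis ∧ q.Valid K vis ∧ w ∈ vis (p.kind p.root) ∧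
      w ∈ vis (q.kind q.root)

/-- Tuples at joined blocks are related by `J`. -/
def Pattern.Agree (J : W → S → S → Prop) : (p : Pattern κ W) → (p.Block → S) → Prop
  | .single _ => fun _ => True
  | .join p q w => fun τ => p.Agree J (fun b => τ (.inl b)) ∧ q.Agree J (fun b => τ (.inr b)) ∧
      J w (τ (.inl p.root)) (τ (.inr q.root))

theorem Pattern.Valid.mono {K K' : Set κ} {vis vis' : κ → Set W} (hK : K ⊆ K')
    (hv : ∀ k, vis k ⊆ vis' k) {p : Pattern κ W} (hp : p.Valid K vis) : p.Valid K' vis' := by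
  induction p with
  | single k => exact hK hp
  | join p q w ihp ihq => exact ⟨ihp hp.1, ihq hp.2.1, hv _ hp.2.2.1, hv _ hp.2.2.2⟩

theorem Pattern.Valid.kind_mem {K : Set κ} {vis : κ → Set W} {p : Pattern κ W}
    (hp : p.Valid K vis) (b : p.Block) : p.kind b ∈ K := by
  induction p with
  | single k => exact hp
  | join p q w ihp ihq =>
    rcases b with b | b
    · exact ihp hp.1 b
    · exact ihq hp.2.1 b

theorem Pattern.Agree.map {S' : Type u} {J : W → S → S → Prop} {J' : W → S' → S' → Prop}
    {f : S → S'} (h : ∀ w σ σ', J w σ σ' → J' w (f σ) (f σ')) {p : Pattern κ W}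
    {τ : p.Block → S} (hτ : p.Agree J τ) : p.Agree J' (fun b => f (τ b)) := by
  induction p with
  | single k => trivial
  | join p q w ihp ihq => exact ⟨ihp hτ.1, ihq hτ.2.1, h _ _ _ hτ.2.2⟩

theorem Pattern.agree_const {J : W → S → S → Prop} {σ : S} (h : ∀ w, J w σ σ)
    (p : Pattern κ W) : p.Agree J (fun _ => σ) := by
  induction p with
  | single k => trivial
  | join p q w ihp ihq => exact ⟨ihp, ihq, h w⟩

/-- A tuple at one block extends to the whole pattern if it extends along every joint. -/
theorem Pattern.exists_extend {K : Set κ} {vis : κ → Set W} {J : W → S → S → Prop}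
    {P : κ → S → Prop} (hJ : ∀ w σ σ', J w σ σ' → J w σ' σ)
    (hstep : ∀ k ∈ K, ∀ k' ∈ K, ∀ w ∈ vis k, w ∈ vis k' → ∀ σ, P k σ → ∃ σ', P k' σ' ∧ J w σ σ')
    {p : Pattern κ W} (hp : p.Valid K vis) (b₀ : p.Block) (σ : S) (hσ : P (p.kind b₀) σ) :
    ∃ τ, (∀ b, P (p.kind b) (τ b)) ∧ p.Agree J τ ∧ τ b₀ = σ := by
  induction p generalizing σ with
  | single k => exact ⟨fun _ => σ, fun _ => hσ, trivial, rfl⟩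
  | join p q w ihp ihq =>
    rcases b₀ with b₀ | b₀
    · obtain ⟨τ, h₁, h₂, h₃⟩ := ihp hp.1 b₀ σ hσ
      obtain ⟨σ', h₄, h₅⟩ := hstep _ (hp.1.kind_mem p.root) _ (hp.2.1.kind_mem q.root) w
        hp.2.2.1 hp.2.2.2 _ (h₁ p.root)
      obtain ⟨τ', h₆, h₇, h₈⟩ := ihq hp.2.1 q.root σ' h₄
      exact ⟨Sum.elim τ τ', Sum.rec h₁ h₆, ⟨h₂, h₇, by simpa [h₈] using h₅⟩, h₃⟩
    · obtain ⟨τ, h₁, h₂, h₃⟩ := ihq hp.2.1 b₀ σ hσ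
      obtain ⟨σ', h₄, h₅⟩ := hstep _ (hp.2.1.kind_mem q.root) _ (hp.1.kind_mem p.root) w
        hp.2.2.2 hp.2.2.1 _ (h₁ q.root)
      obtain ⟨τ', h₆, h₇, h₈⟩ := ihp hp.1 p.root σ' h₄
      exact ⟨Sum.elim τ' τ, Sum.rec h₆ h₁, ⟨h₇, h₂, by simpa [h₈] using hJ _ _ _ h₅⟩, h₃⟩

/-- A nonempty arc-consistent family of domains. -/
def Consistent (K : Set κ) (vis : κ → Set W) (C : κ → (W → A) → Prop) (E : W → Set A) : Prop :=
  (∀ w, (E w).Nonempty) ∧ ∀ k ∈ K, ∀ w ∈ vis k, ∀ x ∈ E w,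
    ∃ s, s w = x ∧ C k s ∧ ∀ w' ∈ vis k, s w' ∈ E w'

/-- Solutions of a pattern with values in `X`. -/
def Pattern.Sat (C : κ → (W → A) → Prop) (X : W → Set A) (p : Pattern κ W)
    (τ : p.Block → W → A) : Prop :=
  (∀ b, C (p.kind b) (τ b) ∧ ∀ w, τ b w ∈ X w) ∧ p.Agree (fun w s s' => s w = s' w) τ

/-- Keep the values that no pattern refutes at its root. They support each other because refutations
of finitely many values can be glued to a single root. -/
theorem exists_consistent [Finite W] [Finite A] {K : Set κ} {vis : κ → Set W}
    {C : κ → (W → A) → Prop} {X : W → Set A} (hX : ∀ w, (X w).Nonempty)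
    (hp : ∀ p : Pattern κ W, p.Valid K vis → ∃ τ, p.Sat C X τ) :
    ∃ E, Consistent K vis C E ∧ ∀ w, E w ⊆ X w := by
  classical
  let E : W → Set A := fun w => {x | x ∈ X w ∧ ∀ p : Pattern κ W, p.Valid K vis →
    w ∈ vis (p.kind p.root) → ∃ τ, p.Sat C X τ ∧ τ p.root w = x}
  -- One pattern with root of kind `k` excludes all discarded values listed in `F` simultaneously.
  have key : ∀ k ∈ K, ∀ F : Finset (W × A), ∃ p : Pattern κ W, p.Valid K vis ∧
      p.kind p.root = k ∧ ∀ τ, p.Sat C X τ → ∀ e ∈ F, e.1 ∈ vis k → e.2 ∉ E e.1 →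
        τ p.root e.1 ≠ e.2 := by
    intro k hk F
    induction F using Finset.induction_on with
    | empty => exact ⟨.single k, hk, rfl, by simp⟩
    | insert e F _ ih =>
      obtain ⟨p, h₁, h₂, h₃⟩ := ih
      by_cases he : e.1 ∈ vis k ∧ e.2 ∉ E e.1 ∧ e.2 ∈ X e.1
      · obtain ⟨he₁, he₂, he₃⟩ := he
        have : ∃ q : Pattern κ W, q.Valid K vis ∧ e.1 ∈ vis (q.kind q.root) ∧
            ∀ τ, q.Sat C X τ → τ q.root e.1 ≠ e.2 := by
          by_contra! hcon
          exact he₂ ⟨he₃, hcon⟩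
        obtain ⟨q, h₄, h₅, h₆⟩ := this
        refine ⟨.join p q e.1, ⟨h₁, h₄, h₂ ▸ he₁, h₅⟩, h₂, fun τ hτ e' he' => ?_⟩
        rcases Finset.mem_insert.1 he' with rfl | he'
        · intro _ _
          have := h₆ (fun b => τ (.inr b)) ⟨fun b => hτ.1 (.inr b), hτ.2.2.1⟩
          rwa [← hτ.2.2.2] at this
        · exact h₃ (fun b => τ (.inl b)) ⟨fun b => hτ.1 (.inl b), hτ.2.1⟩ e' he'
      · refine ⟨p, h₁, h₂, fun τ hτ e' he' => ?_⟩
        rcases Finset.mem_insert.1 he' with rfl | he'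
        · rintro h₄ h₅ h₆
          exact he ⟨h₄, h₅, h₆ ▸ (hτ.1 p.root).2 _⟩
        · exact h₃ τ hτ e' he'
  have key' : ∀ k ∈ K, ∃ p : Pattern κ W, p.Valid K vis ∧ p.kind p.root = k ∧
      ∀ τ, p.Sat C X τ → ∀ w ∈ vis k, τ p.root w ∈ E w := by
    intro k hk
    have := Fintype.ofFinite (W × A)
    obtain ⟨p, h₁, h₂, h₃⟩ := key k hk Finset.univ
    refine ⟨p, h₁, h₂, fun τ hτ w hw => ?_⟩
    by_contra hcon
    exact h₃ τ hτ (w, τ p.root w) (Finset.mem_univ _) hw hcon rfl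
  refine ⟨E, ⟨fun w => ?_, fun k hk w hw x hx => ?_⟩, fun w x hx => hx.1⟩
  · by_cases hw : ∃ k ∈ K, w ∈ vis k
    · obtain ⟨k, hk, hw⟩ := hw
      obtain ⟨p, h₁, h₂, h₃⟩ := key' k hk
      obtain ⟨τ, hτ⟩ := hp p h₁
      exact ⟨_, h₃ τ hτ w hw⟩
    · obtain ⟨x, hx⟩ := hX w
      exact ⟨x, hx, fun p hp hw' => absurd ⟨_, hp.kind_mem _, hw'⟩ hw⟩
  · obtain ⟨p, h₁, h₂, h₃⟩ := key' k hk
    obtain ⟨τ, hτ, rfl⟩ := hx.2 p h₁ (h₂ ▸ hw)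
    exact ⟨τ p.root, rfl, h₂ ▸ (hτ.1 p.root).1, h₃ τ hτ⟩

end Patterns

/-! ### Replacing equalities by identification of variables -/

section Equational
variable {X Y A : Type u}

/-- `x` and `y` are identified by all assignments satisfying `G`. -/
def Forced (G : (X → A) → Prop) (x y : X) : Prop := ∀ τ, G τ → τ x = τ y

/-- `G` is a conjunction of equalities between coordinates. -/
def IsEquational (G : (X → A) → Prop) : Prop :=
  ∀ τ, (∀ x y, Forced G x y → τ x = τ y) → G τ

theorem IsEquational.and {G H : (X → A) → Prop} (hG : IsEquational G) (hH : IsEquational H) :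
    IsEquational (fun τ => G τ ∧ H τ) := fun τ h =>
  ⟨hG τ fun x y hxy => h x y fun τ hτ => hxy τ hτ.1,
    hH τ fun x y hxy => h x y fun τ hτ => hxy τ hτ.2⟩

theorem IsEquational.forall {ι : Sort*} {G : ι → (X → A) → Prop} (hG : ∀ i, IsEquational (G i)) :
    IsEquational (fun τ => ∀ i, G i τ) := fun τ h i =>
  hG i τ fun x y hxy => h x y fun τ hτ => hxy τ (hτ i)

theorem IsEquational.true : IsEquational (fun _ : X → A => True) := fun _ _ => trivial

theorem IsEquational.eq (x y : X) : IsEquational (fun τ : X → A => τ x = τ y) := fun _ h =>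
  h x y fun _ => id

theorem IsEquational.comp {G : (X → A) → Prop} (hG : IsEquational G) (f : X → Y) :
    IsEquational (fun τ : Y → A => G (fun x => τ (f x))) := fun _ h =>
  hG _ fun _ _ hxy => h _ _ fun _ hτ => hxy _ hτ

theorem Pattern.agree_isEquational {κ W : Type u} {J : W → (X → A) → (X → A) → Prop}
    (hJ : ∀ w, IsEquational fun τ : X ⊕ X → A => J w (fun x => τ (.inl x)) (fun x => τ (.inr x)))
    (p : Pattern κ W) :
    IsEquational fun τ : p.Block × X → A => p.Agree J (fun b x => τ (b, x)) := by
  induction p with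
  | single k => exact .true
  | join p q w ihp ihq =>
    refine .and (ihp.comp fun x => ((.inl x.1, x.2) : (p.Block ⊕ q.Block) × X))
      (.and (ihq.comp fun x => ((.inr x.1, x.2) : (p.Block ⊕ q.Block) × X)) ?_)
    exact (hJ w).comp (Y := (p.Block ⊕ q.Block) × X)
      (Sum.elim (fun x => (.inl p.root, x)) (fun x => (.inr q.root, x)))

def forcedSetoid (G : (X → A) → Prop) : Setoid X where
  r := Forced G
  iseqv := ⟨fun _ _ _ => rfl, fun h τ hτ => (h τ hτ).symm,
    fun h h' τ hτ => (h τ hτ).trans (h' τ hτ)⟩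

/-- Identify the forced coordinates of `Φ`. -/
def ATup.quot (Φ : ATup A X) (G : (X → A) → Prop) : ATup A (Quotient (forcedSetoid G)) :=
  fun z α h => Φ z α fun x => h ⟦x⟧

theorem ATup.Def.quot {Γ : ConstraintLanguage A} {Φ : ATup A X} (hΦ : ATup.Def Γ Φ)
    (G : (X → A) → Prop) : ATup.Def Γ (Φ.quot G) := fun _ zf αf g =>
  hΦ zf αf fun x => g ⟦x⟧

theorem IsEquational.quot {G : (X → A) → Prop} (hG : IsEquational G)
    (h : Quotient (forcedSetoid G) → A) : G fun x => h ⟦x⟧ :=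
  hG _ fun _ _ hxy => congrArg h (Quotient.sound (s := forcedSetoid G) hxy)

theorem IsEquational.exists_quot {G : (X → A) → Prop} {τ : X → A} (hτ : G τ) :
    ∃ h : Quotient (forcedSetoid G) → A, τ = fun x => h ⟦x⟧ :=
  ⟨Quotient.lift τ fun _ _ h => h τ hτ, rfl⟩

end Equational

/-! ### The constraints at words, and moving one level down -/

section Nodes
variable {A : Type u} {n : ℕ}

/-- Words of length at most `n`, the indices of the variables of the induced instance. -/
abbrev Node (A : Type u) (n : ℕ) := {l : List A // l.length ≤ n}

def Node.len (q : Node A n) : ℕ := q.1.length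

def Node.pre (q : Node A n) (i : ℕ) : Node A n :=
  ⟨q.1.take i, by rw [List.length_take]; exact (min_le_right _ _).trans q.2⟩

theorem Node.len_le (q : Node A n) : q.len ≤ n := q.2

theorem Node.len_pre (q : Node A n) (i : ℕ) : (q.pre i).len = min i q.len := List.length_take

theorem Node.pre_pre (q : Node A n) (i j : ℕ) : (q.pre i).pre j = q.pre (min j i) :=
  Subtype.ext (List.take_take ..)

theorem Node.pre_of_le {q : Node A n} {i : ℕ} (h : q.len ≤ i) : q.pre i = q :=
  Subtype.ext (List.take_of_length_le h)

instance [Finite A] : Finite (Node A n) := (List.finite_length_le A n).to_subtype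

/-- The relation `𝒮_R` at the node `q`, with the values of `x` and `x'` routed through `α`. -/
def nodeRel (R : Set (Fin (n + 1 + n) → A)) (q : Node A n) : ATup A (Node A n) := fun z α s =>
  ∀ b, ∃ β, ∀ b', ∃ y : Fin (n + 1) → A,
    Fin.append (fun i : Fin (n + 1) => if (i : ℕ) ≤ q.len then s (q.pre i)
        else if (i : ℕ) = q.len + 1 then β else y i)
      (fun j : Fin n => if h : (j : ℕ) < q.len then z (q.1[(j : ℕ)]'h)
        else if (j : ℕ) = q.len then α b else α b') ∈ R

variable {R : Set (Fin (n + 1 + n) → A)}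

theorem nodeRel_def [Finite A] {Γ : ConstraintLanguage A} (hΓ : HasNonempty Γ)
    (hR : ⟨n + 1 + n, R⟩ ∈ Γ) (q : Node A n) : ATup.Def Γ (nodeRel R q) := by
  intro X zf αf g
  refine QDef.forall_index hΓ fun b => QDef.exists_elem (QDef.forall_index hΓ fun b' => ?_)
  refine (QDef.exists_fun (ι := ULift.{u} (Fin (n + 1))) (V := Option X)
    (P := fun s y => Fin.append (fun i : Fin (n + 1) => if (i : ℕ) ≤ q.len then s (some (g (q.pre i)))
        else if (i : ℕ) = q.len + 1 then s none else y ⟨i⟩)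
      (fun j : Fin n => if h : (j : ℕ) < q.len then s (some (zf (q.1[(j : ℕ)]'h)))
        else if (j : ℕ) = q.len then s (some (αf b)) else s (some (αf b'))) ∈ R) ?_).congr
    fun s => ⟨fun ⟨y, hy⟩ => ⟨fun i => y i.down, hy⟩, fun ⟨y, hy⟩ => ⟨fun i => y ⟨i⟩, hy⟩⟩
  refine (QDef.atom hR (Fin.append
    (fun i : Fin (n + 1) => if (i : ℕ) ≤ q.len then Sum.inl (some (g (q.pre i)))
        else if (i : ℕ) = q.len + 1 then Sum.inl none else Sum.inr (ULift.up i))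
    (fun j : Fin n => if h : (j : ℕ) < q.len then Sum.inl (some (zf (q.1[(j : ℕ)]'h)))
        else if (j : ℕ) = q.len then Sum.inl (some (αf b)) else Sum.inl (some (αf b'))))).congr
    fun s => ?_
  apply iff_of_eq
  congr 1
  funext i
  refine Fin.addCases (fun i => ?_) (fun i => ?_) i
  · simp only [Fin.append_left]
    split_ifs <;> rfl
  · simp only [Fin.append_right]
    split_ifs <;> rfl

/-- A general `α` merely restricts the range of the universal variables to its image. -/
theorem nodeRel_mono (q : Node A n) {z α : A → A} {s : Node A n → A}
    (h : nodeRel R q z id s) : nodeRel R q z α s := fun b => by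
  obtain ⟨β, hβ⟩ := h (α b)
  exact ⟨β, fun b' => hβ (α b')⟩

theorem nodeRel_congr {q : Node A n} {z α : A → A} {s s' : Node A n → A}
    (h : ∀ i ≤ q.len, s (q.pre i) = s' (q.pre i)) (hs : nodeRel R q z α s) :
    nodeRel R q z α s' := fun b => by
  obtain ⟨β, hβ⟩ := hs b
  refine ⟨β, fun b' => ?_⟩
  obtain ⟨y, hy⟩ := hβ b'
  refine ⟨y, ?_⟩
  convert hy using 3 with i
  split_ifs with hi
  · exact (h _ hi).symm
  · rfl
  · rfl

/-- The new value is the answer to `x = z_a`, with `a` the last letter of `p`. It is chosen before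
`x'`, so it does not depend on `c`; the answer to `x' = c` supplies all later coordinates at once.
-/
theorem nodeRel_extend {p : Node A n} {l : ℕ} (hp : p.len = l + 1) {z : A → A}
    {s : Node A n → A} (hs : nodeRel R (p.pre l) z id s) :
    ∃ y, ∀ s' : Node A n → A, (∀ i ≤ l, s' (p.pre i) = s (p.pre i)) → s' p = y →
      ∀ c, nodeRel R p z (fun _ => c) s' := by
  have hl : (p.pre l).len = l := by rw [Node.len_pre]; omega
  have hll : l < p.1.length := by change l < p.len; omega
  obtain ⟨y, hy⟩ := hs (z p.1[l])
  refine ⟨y, fun s' h₁ h₂ c b => ?_⟩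
  obtain ⟨t, ht⟩ := hy c
  -- The default `c` is never read: when the test fails there is no coordinate `y_{l+2}`.
  refine ⟨if h : l + 2 < n + 1 then t ⟨l + 2, h⟩ else c, fun b' => ⟨t, ?_⟩⟩
  convert ht using 3 with i j
  · rw [hp, hl, Node.pre_pre]
    by_cases hi : (i : ℕ) ≤ l
    · rw [if_pos (by omega), if_pos hi, h₁ _ hi, min_eq_left hi]
    · rw [if_neg hi]
      by_cases hi' : (i : ℕ) = l + 1
      · rw [if_pos hi'.le, if_pos hi', hi', Node.pre_of_le (by omega), h₂]
      · rw [if_neg (by omega), if_neg hi']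
        split_ifs with h₃ h₄
        · congr 1; exact Fin.ext h₃.symm
        · omega
        · rfl
  · by_cases hj : (j : ℕ) < l
    · rw [dif_pos (show (j : ℕ) < p.len by omega), dif_pos (show (j : ℕ) < (p.pre l).len by omega)]
      exact congrArg z (List.getElem_take ..).symm
    · by_cases hj' : (j : ℕ) = l
      · rw [dif_pos (show (j : ℕ) < p.len by omega),
          dif_neg (show ¬ (j : ℕ) < (p.pre l).len by omega),
          if_pos (show (j : ℕ) = (p.pre l).len by omega)]
        simp only [hj', id]
      · rw [dif_neg (show ¬ (j : ℕ) < p.len by omega),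
          dif_neg (show ¬ (j : ℕ) < (p.pre l).len by omega),
          if_neg (show ¬ (j : ℕ) = (p.pre l).len by omega)]
        split_ifs <;> rfl

open Classical in
/-- Choose values at level `l + 1` that make the relations of that level true for constant `α`. -/
noncomputable def extend (R : Set (Fin (n + 1 + n) → A)) (z : A → A) (l : ℕ) (s : Node A n → A) :
    Node A n → A := fun p =>
  if h : p.len = l + 1 ∧ nodeRel R (p.pre l) z id s then (nodeRel_extend h.1 h.2).choose else s p

theorem extend_of_ne {z : A → A} {l : ℕ} {s : Node A n → A} {p : Node A n} (h : p.len ≠ l + 1) :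
    extend R z l s p = s p := dif_neg fun h' => h h'.1

theorem nodeRel_extend_level {z : A → A} {l : ℕ} {s : Node A n → A} {p : Node A n}
    (hp : p.len = l + 1) (hs : nodeRel R (p.pre l) z id s) (c : A) :
    nodeRel R p z (fun _ => c) (extend R z l s) := by
  refine (nodeRel_extend hp hs).choose_spec _ (fun i hi => extend_of_ne ?_) (dif_pos ⟨hp, hs⟩) c
  rw [Node.len_pre]; omega

theorem nodeRel_extend_below {z : A → A} {l : ℕ} {s : Node A n → A} {p : Node A n}
    (hp : p.len ≤ l) (hs : nodeRel R p z id s) (c : A) :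
    nodeRel R p z (fun _ => c) (extend R z l s) := by
  refine nodeRel_congr (fun i hi => (extend_of_ne ?_).symm) (nodeRel_mono p hs)
  rw [Node.len_pre]; omega

theorem nodeRel_id_iff {q : Node A n} {z : A → A} {s : Node A n → A} :
    nodeRel R q z id s ↔ sRel R q.len (Nat.lt_succ_of_le q.2) (fun i => s (q.pre i))
      (fun j => z (q.1[(j : ℕ)]'j.2)) := by
  refine forall_congr' fun b => exists_congr fun β => forall_congr' fun b' => ⟨?_, ?_⟩
  · rintro ⟨y, hy⟩
    refine ⟨_, fun i => ?_, fun h => ?_, hy⟩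
    · simp [Nat.le_of_lt_succ i.2]
    · simp
  · rintro ⟨y, h₁, h₂, h₃⟩
    refine ⟨y, ?_⟩
    convert h₃ using 3 with i
    split_ifs with hi hi'
    · exact (h₁ ⟨i, Nat.lt_succ_of_le hi⟩).symm
    · rw [← h₂ (hi' ▸ i.2)]
      congr 1; exact Fin.ext hi'.symm
    · rfl
    · rfl

def Node.toVar (q : Node A n) : YVar A n :=
  ⟨⟨q.len, Nat.lt_succ_of_le q.2⟩, fun i => q.1[(i : ℕ)]'i.2⟩

def Node.ofVar (p : YVar A n) : Node A n :=
  ⟨List.ofFn p.2, by rw [List.length_ofFn]; exact Nat.le_of_lt_succ p.1.2⟩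

theorem Node.ofVar_toVar (q : Node A n) : Node.ofVar q.toVar = q :=
  Subtype.ext (List.ofFn_getElem ..)

theorem YVar.ext' {p p' : YVar A n} (h : (p.1 : ℕ) = p'.1)
    (h' : ∀ (i : ℕ) (hi : i < p.1), p.2 ⟨i, hi⟩ = p'.2 ⟨i, h ▸ hi⟩) : p = p' := by
  obtain ⟨m, f⟩ := p
  obtain ⟨m', f'⟩ := p'
  obtain rfl : m = m' := Fin.ext h
  congr 1
  funext i
  exact h' i i.2

theorem Node.toVar_ofVar (p : YVar A n) : (Node.ofVar p).toVar = p :=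
  YVar.ext' (List.length_ofFn ..) fun _ _ => List.getElem_ofFn ..

theorem Node.scope_toVar (q : Node A n) (i : Fin (inducedConstraint R q.toVar).arity) :
    (inducedConstraint R q.toVar).scope i = (q.pre i).toVar :=
  YVar.ext' (by
    change (i : ℕ) = (q.pre i).len
    rw [Node.len_pre]
    exact (min_eq_left (Nat.le_of_lt_succ i.2)).symm)
    fun _ _ => (List.getElem_take ..).symm

end Nodes

/-! ### Merging constraints, and minimal consistent domains -/

section Phases
variable {A : Type u} {n : ℕ} {R : Set (Fin (n + 1 + n) → A)} {Γ : ConstraintLanguage A} {j : ℕ}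

/-- Kinds of constraints: the conjunction of all short nodes, or a single long node. -/
abbrev Kind (A : Type u) (n : ℕ) := Option (Node A n)

def allowed (A : Type u) (n j : ℕ) : Set (Kind A n) := {k | ∀ q, k = some q → j ≤ q.len}

def visible (j : ℕ) : Kind A n → Set (Node A n)
  | none => {w | w.len < j}
  | some q => {w | w = q.pre w.len}

def kindRel (R : Set (Fin (n + 1 + n) → A)) (j : ℕ) (z : A → A) :
    Kind A n → (Node A n → A) → Prop
  | none => fun s => ∀ p : Node A n, p.len < j → nodeRel R p z id s
  | some q => nodeRel R q z id

/-- Consistency of the instance in which all constraints at nodes shorter than `j` have been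
merged into one. -/
def Good (R : Set (Fin (n + 1 + n) → A)) (j : ℕ) (z : A → A) (E : Node A n → Set A) : Prop :=
  Consistent (allowed A n j) (visible j) (kindRel R j z) E

theorem none_mem_allowed : none ∈ allowed A n j := fun _ h => nomatch h

theorem some_mem_allowed {q : Node A n} : some q ∈ allowed A n j ↔ j ≤ q.len :=
  ⟨fun h => h q rfl, fun h _ hq => Option.some.inj hq ▸ h⟩

theorem pre_mem_visible (q : Node A n) (i : ℕ) : q.pre i ∈ visible j (some q) := by
  change q.pre i = q.pre (q.pre i).len
  rw [Node.len_pre]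
  rcases le_total i q.len with h | h
  · rw [min_eq_left h]
  · rw [min_eq_right h, Node.pre_of_le h, Node.pre_of_le le_rfl]

theorem kindRel_congr {z : A → A} {k : Kind A n} {s s' : Node A n → A}
    (h : ∀ w ∈ visible j k, s w = s' w) (hs : kindRel R j z k s) : kindRel R j z k s' := by
  cases k with
  | none =>
    exact fun p hp => nodeRel_congr (fun i hi => h _ (by
      change (p.pre i).len < j
      rw [Node.len_pre]; omega)) (hs p hp)
  | some q => exact nodeRel_congr (fun i _ => h _ (pre_mem_visible q i)) hs

theorem kindRel_def [Finite A] (hΓ : HasNonempty Γ) (hR : ⟨n + 1 + n, R⟩ ∈ Γ) (k : Kind A n)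
    {X : Type u} (zf : A → X) (g : Node A n → X) :
    QDef Γ fun s => kindRel R j (fun a => s (zf a)) k fun w => s (g w) := by
  have key : ∀ q : Node A n, QDef Γ fun s => nodeRel R q (fun a => s (zf a)) id
      fun w => s (g w) := fun q =>
    (QDef.forall_fun (ι := A) (V := X)
      (P := fun s α => nodeRel R q (fun a => s (zf a)) α fun w => s (g w))
      (nodeRel_def hΓ hR q (fun a => Sum.inl (zf a)) Sum.inr (fun w => Sum.inl (g w)))).congr
      fun s => ⟨fun h α => nodeRel_mono q h, fun h => h id⟩
  cases k with
  | none => exact QDef.forall_index hΓ fun p => QDef.imp hΓ fun _ => key p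
  | some q => exact key q

def Node.nil : Node A n := ⟨[], Nat.zero_le n⟩

theorem nil_mem_visible (hj : 1 ≤ j) (k : Kind A n) : Node.nil ∈ visible j k := by
  cases k with
  | none => exact hj
  | some q => exact pre_mem_visible q 0

/-- Coordinates outside the scope are filled with arbitrary values of `E`. The empty word is always
visible when `1 ≤ j`, which gives a tuple even if `w` is invisible. -/
theorem Good.exists_total {z : A → A} {E : Node A n → Set A} (hE : Good R j z E) (hj : 1 ≤ j)
    {k : Kind A n} (hk : k ∈ allowed A n j) (w : Node A n) {x : A} (hx : x ∈ E w) :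
    ∃ s, s w = x ∧ kindRel R j z k s ∧ ∀ w', s w' ∈ E w' := by
  classical
  have key : ∃ s, (w ∈ visible j k → s w = x) ∧ kindRel R j z k s ∧
      ∀ w' ∈ visible j k, s w' ∈ E w' := by
    by_cases hw : w ∈ visible j k
    · obtain ⟨s, h₁, h₂⟩ := hE.2 k hk w hw x hx
      exact ⟨s, fun _ => h₁, h₂⟩
    · obtain ⟨y, hy⟩ := hE.1 Node.nil
      obtain ⟨s, -, h₂⟩ := hE.2 k hk _ (nil_mem_visible hj k) y hy
      exact ⟨s, fun h => absurd h hw, h₂⟩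
  obtain ⟨s, h₁, h₂, h₃⟩ := key
  refine ⟨fun w' => if w' ∈ visible j k then s w' else if w' = w then x else (hE.1 w').some,
    ?_, kindRel_congr (fun w' hw' => (if_pos hw').symm) h₂, fun w' => ?_⟩
  · dsimp only
    split_ifs with h
    · exact h₁ h
    · rfl
    · contradiction
  · dsimp only
    split_ifs with h h'
    · exact h₃ _ h
    · exact h' ▸ hx
    · exact (hE.1 w').some_mem

theorem good_one_of_oneConsistent {D : ZReduction A (YVar A n)} (hne : D.IsNonempty)
    (hcons : D.IsOneConsistent (inducedInstance R)) (z : A → A) : ∃ E, Good R 1 z E := by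
  classical
  refine ⟨fun w => D w.toVar z, fun w => hne _ _, ?_⟩
  have key : ∀ q w : Node A n, w = q.pre w.len → ∀ x ∈ D w.toVar z, ∃ s : Node A n → A,
      s w = x ∧ nodeRel R q z id s ∧ ∀ w' : Node A n, w' = q.pre w'.len → s w' ∈ D w'.toVar z := by
    intro q w hw x hx
    have hlen : ∀ w : Node A n, w = q.pre w.len → w.len < q.len + 1 := fun w hw => by
      have := congrArg Node.len hw
      rw [Node.len_pre] at this
      omega
    have := hcons _ ⟨q.toVar, rfl⟩ ⟨w.len, hlen w hw⟩ z
    rw [Node.scope_toVar, ← hw] at this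
    rw [← this] at hx
    obtain ⟨t, ⟨h₁, h₂⟩, h₃⟩ := hx
    refine ⟨fun w => if h : w.len < q.len + 1 then t ⟨w.len, h⟩ else x, ?_, ?_, fun w' hw' => ?_⟩
    · dsimp only
      rw [dif_pos (hlen w hw)]
      exact h₃
    · rw [nodeRel_id_iff]
      have h₄ : sRel R q.len (Nat.lt_succ_of_le q.2) t (fun j => z (q.1[(j : ℕ)]'j.2)) := h₁
      have h₅ : (fun i : Fin (q.len + 1) => if h : (q.pre i).len < q.len + 1 then
          t ⟨(q.pre i).len, h⟩ else x) = t := funext fun i => by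
        have hi : (q.pre i).len = i := by rw [Node.len_pre]; omega
        rw [dif_pos (by omega)]
        exact congrArg t (Fin.ext hi)
      rw [← h₅] at h₄
      exact h₄
    · dsimp only
      rw [dif_pos (hlen w' hw')]
      have := h₂ ⟨w'.len, hlen w' hw'⟩
      rw [Node.scope_toVar, ← hw'] at this
      exact this
  intro k _ w hw x hx
  cases k with
  | none =>
    have hnil : ∀ w : Node A n, w.len < 1 → w = Node.nil := fun w hw =>
      Subtype.ext (List.eq_nil_of_length_eq_zero (Nat.lt_one_iff.1 hw))
    have hw' := hnil w hw
    obtain ⟨s, h₁, h₂, h₃⟩ := key w w (Node.pre_of_le le_rfl).symm x hx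
    refine ⟨s, h₁, fun p hp => (hnil p hp).trans hw'.symm ▸ h₂, fun w' hw'' => h₃ w' ?_⟩
    rw [(hnil w' hw'').trans hw'.symm, Node.pre_of_le le_rfl]
  | some q => exact key q w hw x hx

theorem exists_isSolution_of_good {z : A → A} {E : Node A n → Set A} (hE : Good R (n + 1) z E) :
    ∃ s : YVar A n → A, (inducedInstance R).IsSolution z s := by
  obtain ⟨x, hx⟩ := hE.1 Node.nil
  obtain ⟨s, -, h, -⟩ := hE.2 none none_mem_allowed Node.nil (Nat.succ_pos n) x hx
  refine ⟨fun p => s (Node.ofVar p), ?_⟩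
  rintro _ ⟨p, rfl⟩
  obtain ⟨q, rfl⟩ : ∃ q : Node A n, q.toVar = p := ⟨_, Node.toVar_ofVar p⟩
  have := nodeRel_id_iff.1 (h q (Nat.lt_succ_of_le q.2))
  have hs : ∀ i, s (q.pre i) = s (Node.ofVar (q.pre i).toVar) := fun i => by
    rw [Node.ofVar_toVar]
  simp only [hs] at this
  have key : (fun i : Fin (inducedConstraint R q.toVar).arity => s (Node.ofVar ((inducedConstraint R q.toVar).scope i))) =
      fun i : Fin (inducedConstraint R q.toVar).arity => s (Node.ofVar (q.pre i).toVar) := funext fun i => by rw [Node.scope_toVar]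
  change (fun i => s (Node.ofVar ((inducedConstraint R q.toVar).scope i))) ∈ _
  rw [key]
  exact this

/-- A q-definable consistent family that is minimal on the nodes shorter than `j`. -/
theorem exists_minimal_good [Finite A] (hΓ : HasNonempty Γ) (hR : ⟨n + 1 + n, R⟩ ∈ Γ)
    (hgood : ∀ z, ∃ E, Good R j z E) : ∃ E : Node A n → ZUnary A,
      (∀ w, ZUnary.Def Γ (E w)) ∧ (∀ z, Good R j z fun w => E w z) ∧
      ∀ v : Node A n, v.len < j → ∀ B, ZUnary.Def Γ B → (∀ z, B z ⊆ E v z) →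
        (∃ z, B z ≠ E v z) → ∃ z, ¬ ∃ E', Good R j z E' ∧ E' v ⊆ B z ∧
          ∀ w : Node A n, w.len < j → E' w ⊆ E w z := by
  classical
  let G : (Node A n → ZUnary A) → Prop := fun D =>
    (∀ w, ZUnary.Def Γ (D w)) ∧ ∀ z, ∃ E', Good R j z E' ∧ ∀ w, E' w ⊆ D w z
  have huniv : ZUnary.Def Γ (fun _ => (Set.univ : Set A)) := fun X zf x => QDef.true hΓ
  -- Minimize first with unrestricted long words, then among all families below. The first step
  -- gives minimality on short words against competitors that are free on long words; the second
  -- gives arc-consistency.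
  obtain ⟨D, ⟨hD, hDu⟩, hDmin⟩ := exists_minimal_of_wellFoundedLT
    (fun D : Node A n → ZUnary A => G D ∧ ∀ w : Node A n, j ≤ w.len → ∀ z, D w z = Set.univ)
    ⟨fun _ _ => Set.univ, ⟨fun _ => huniv, fun z => (hgood z).imp fun E hE =>
      ⟨hE, fun _ => Set.subset_univ _⟩⟩, fun _ _ _ => rfl⟩
  obtain ⟨E, ⟨hE, hED⟩, hEmin⟩ := exists_minimal_of_wellFoundedLT
    (fun E : Node A n → ZUnary A => G E ∧ E ≤ D) ⟨D, hD, le_rfl⟩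
  have hlow : ∀ v : Node A n, v.len < j → ∀ z, D v z ⊆ E v z := by
    intro v hv z
    have := hDmin (y := fun w z => if w.len < j then E w z else Set.univ) ⟨⟨fun w => ?_, fun z => ?_⟩,
      fun w hw z => if_neg hw.not_gt⟩ (fun w z => ?_) v z
    · dsimp only at this
      rwa [if_pos hv] at this
    · by_cases hw : w.len < j
      · simpa only [hw, if_true] using hE.1 w
      · simpa only [hw, if_false] using huniv
    · obtain ⟨E', h₁, h₂⟩ := hE.2 z
      refine ⟨E', h₁, fun w => ?_⟩
      dsimp only
      split_ifs
      · exact h₂ w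
      · exact Set.subset_univ _
    · dsimp only
      split_ifs with hw
      · exact hED w z
      · exact (hDu w (not_lt.1 hw) z).ge
  refine ⟨E, hE.1, fun z => ⟨fun w => ?_, ?_⟩, fun v hv B hB hBE hBne => ?_⟩
  · obtain ⟨E', h₁, h₂⟩ := hE.2 z
    exact (h₁.1 w).mono (h₂ w)
  · have := hEmin (y := fun w z => {x | x ∈ E w z ∧ ∀ k : Kind A n, k ∈ allowed A n j →
      w ∈ visible j k → ∃ s : Node A n → A, (kindRel R j z k s ∧ ∀ w', w' ∈ visible j k →
        s w' ∈ E w' z) ∧ s w = x})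
      ⟨⟨fun w X zf x => ?_, fun z => ?_⟩, fun w z x hx => hED w z hx.1⟩ (fun w z x hx => hx.1)
    · intro k hk w hw x hx
      obtain ⟨s, ⟨h₁, h₂⟩, h₃⟩ := (this w z hx).2 k hk hw
      exact ⟨s, h₃, h₁, h₂⟩
    · refine (hE.1 w zf x).and (QDef.forall_index hΓ fun k => QDef.imp hΓ fun _ =>
        QDef.imp hΓ fun _ => ?_)
      refine (QDef.exists_pinned (V := Node A n) (X := X)
        (P := fun s h => kindRel R j (fun a => s (zf a)) k h ∧ ∀ w', w' ∈ visible j k →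
          h w' ∈ E w' fun a => s (zf a))
        ((kindRel_def hΓ hR k (fun a => Sum.inl (zf a)) Sum.inr).and
          (QDef.forall_index hΓ fun w' => QDef.imp hΓ fun _ =>
            hE.1 w' (fun a => Sum.inl (zf a)) (Sum.inr w')))
        (fun v => if v = w then some x else none)).congr fun s => ?_
      refine exists_congr fun h => ?_
      simp
    · obtain ⟨E', h₁, h₂⟩ := hE.2 z
      refine ⟨E', h₁, fun w x hx => ⟨h₂ w hx, fun k hk hw => ?_⟩⟩
      obtain ⟨s, h₃, h₄, h₅⟩ := h₁.2 k hk w hw x hx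
      exact ⟨s, ⟨h₄, fun w' hw' => h₂ w' (h₅ w' hw')⟩, h₃⟩
  · by_contra! hcon
    obtain ⟨z, hz⟩ := hBne
    have := hDmin (y := fun w z => if w = v then B z else if w.len < j then E w z else Set.univ)
      ⟨⟨fun w => ?_, fun z => ?_⟩, fun w hw z => ?_⟩ (fun w z => ?_) v z
    · dsimp only at this
      rw [if_pos rfl] at this
      exact hz (Set.Subset.antisymm (hBE z) ((hED v z).trans this))
    · by_cases hwv : w = v
      · simpa only [hwv, if_true] using hB
      · by_cases hw : w.len < j
        · simpa only [hwv, hw, if_true, if_false] using hE.1 w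
        · simpa only [hwv, hw, if_false] using huniv
    · obtain ⟨E', h₁, h₂, h₃⟩ := hcon z
      refine ⟨E', h₁, fun w => ?_⟩
      dsimp only
      split_ifs with h h'
      · exact h ▸ h₂
      · exact h₃ w h'
      · exact Set.subset_univ _
    · dsimp only
      rw [if_neg (by rintro rfl; omega), if_neg hw.not_gt]
    · dsimp only
      split_ifs with h h'
      · exact h ▸ (hBE z).trans (hED v z)
      · exact hED w z
      · exact (hDu w (not_lt.1 h') z).ge

end Phases

/-! ### Blocks with private copies of the short variables -/

section Blocks
variable {A : Type u} {n : ℕ} {R : Set (Fin (n + 1 + n) → A)} {Γ : ConstraintLanguage A} {j : ℕ}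

/-- Coordinates of a block: the nodes, and for every node a private copy of each node. -/
abbrev Coord (A : Type u) (n : ℕ) := Node A n ⊕ (Node A n × Node A n)

def Coord.sort : Coord A n → Node A n := Sum.elim id Prod.snd

/-- The relation of a block at level `l`. A block of kind `none` uses a private copy of the short
nodes for every node of length `j`. -/
def blockRel (R : Set (Fin (n + 1 + n) → A)) (j l : ℕ) : Kind A n → ATup A (Coord A n)
  | none => fun z α σ => (∀ p : Node A n, p.len < j → nodeRel R p z α fun w => σ (.inl w)) ∧
      ∀ q : Node A n, q.len = j →
        nodeRel R q z α fun w => if w.len < j then σ (.inr (q, w)) else σ (.inl w)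
  | some q => fun z α σ => nodeRel R (q.pre l) z α fun w => σ (.inl w)

theorem blockRel_def [Finite A] (hΓ : HasNonempty Γ) (hR : ⟨n + 1 + n, R⟩ ∈ Γ) (l : ℕ)
    (k : Kind A n) : ATup.Def Γ (blockRel R j l k) := by
  intro X zf αf g
  cases k with
  | none =>
    refine (QDef.forall_index hΓ fun p => QDef.imp hΓ fun _ =>
      nodeRel_def hΓ hR p zf αf fun w => g (.inl w)).and
      (QDef.forall_index hΓ fun q => QDef.imp hΓ fun _ =>
        (nodeRel_def hΓ hR q zf αf
          fun w => if w.len < j then g (.inr (q, w)) else g (.inl w)).congr fun s => ?_)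
    simp only [apply_ite s]
  | some q => exact nodeRel_def hΓ hR _ zf αf fun w => g (.inl w)

theorem blockRel_mono {l : ℕ} {k : Kind A n} {z α : A → A} {σ : Coord A n → A}
    (h : blockRel R j l k z id σ) : blockRel R j l k z α σ := by
  cases k with
  | none => exact ⟨fun p hp => nodeRel_mono p (h.1 p hp), fun q hq => nodeRel_mono q (h.2 q hq)⟩
  | some q => exact nodeRel_mono (s := fun w => σ (.inl w)) (q.pre l) h

/-- Tuples of adjacent blocks agree at the joint; if the joint is deep they coincide. -/
def joint (l : ℕ) (w : Node A n) (σ σ' : Coord A n → A) : Prop :=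
  (w.len ≤ l → σ (.inl w) = σ' (.inl w)) ∧ (l < w.len → ∀ c, σ c = σ' c)

noncomputable def extendBlock (R : Set (Fin (n + 1 + n) → A)) (z : A → A) (l : ℕ)
    (σ : Coord A n → A) : Coord A n → A :=
  Sum.elim (extend R z l fun w => σ (.inl w)) fun e => σ (.inr e)

theorem extendBlock_of_ne {z : A → A} {l : ℕ} {σ : Coord A n → A} {c : Coord A n}
    (hc : c.sort.len ≠ l + 1) : extendBlock R z l σ c = σ c := by
  rcases c with w | e
  · exact extend_of_ne hc
  · rfl

/-- The chosen values depend only on the tuple, so tuples that coincide below a deep joint get the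
same new values and agree at it once it is reached. -/
theorem joint_extendBlock {z : A → A} {l : ℕ} {w : Node A n} {σ σ' : Coord A n → A}
    (h : joint l w σ σ') :
    joint (l + 1) w (extendBlock R z l σ) (extendBlock R z l σ') := by
  by_cases hw : w.len ≤ l
  · refine ⟨fun _ => ?_, fun h' => by omega⟩
    rw [extendBlock_of_ne (by change w.len ≠ l + 1; omega),
      extendBlock_of_ne (by change w.len ≠ l + 1; omega), h.1 hw]
  · have : σ = σ' := funext (h.2 (not_le.1 hw))
    subst this
    exact ⟨fun _ => rfl, fun _ _ => rfl⟩

theorem blockRel_extendBlock {l : ℕ} (hl : j ≤ l) {k : Kind A n} {z : A → A}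
    {σ : Coord A n → A} (h : blockRel R j l k z id σ) (c : A) :
    blockRel R j (l + 1) k z (fun _ => c) (extendBlock R z l σ) := by
  cases k with
  | none =>
    refine ⟨fun p hp => nodeRel_extend_below (by omega) (h.1 p hp) c, fun q hq => ?_⟩
    refine nodeRel_congr (fun i hi => ?_) (nodeRel_mono q (h.2 q hq))
    have : (q.pre i).len = i := by rw [Node.len_pre]; omega
    rw [extendBlock_of_ne (by change (q.pre i).len ≠ l + 1; omega),
      extendBlock_of_ne (by change (q.pre i).len ≠ l + 1; omega)]
  | some q =>
    change nodeRel R (q.pre (l + 1)) z (fun _ => c) (extend R z l fun w => σ (.inl w))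
    replace h : nodeRel R (q.pre l) z id fun w => σ (.inl w) := h
    by_cases hq : q.len ≤ l
    · have h' : q.pre (l + 1) = q.pre l := by
        rw [Node.pre_of_le hq, Node.pre_of_le (by omega)]
      rw [h']
      exact nodeRel_extend_below (by rw [Node.len_pre]; omega) h c
    · refine nodeRel_extend_level (by rw [Node.len_pre]; omega) ?_ c
      rw [Node.pre_pre, min_eq_left (Nat.le_succ l)]
      exact h

/-- A tuple of the short nodes gives one tuple that fits all blocks at level `j` for constant
`α`. -/
theorem exists_blockRel_const (hj : 1 ≤ j) {z : A → A} {s : Node A n → A}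
    (hs : ∀ p : Node A n, p.len < j → nodeRel R p z id s) : ∃ σ : Coord A n → A,
      (∀ c : Coord A n, c.sort.len < j → σ c = s c.sort) ∧
      ∀ k ∈ allowed A n j, ∀ c, blockRel R j j k z (fun _ => c) σ := by
  obtain ⟨i, rfl⟩ : ∃ i, j = i + 1 := ⟨j - 1, by omega⟩
  have hlev : ∀ q : Node A n, q.len = i + 1 → ∀ c,
      nodeRel R q z (fun _ => c) (extend R z i s) := fun q hq c =>
    nodeRel_extend_level hq (hs _ (by rw [Node.len_pre]; omega)) c
  refine ⟨Sum.elim (extend R z i s) fun e => s e.2, ?_, ?_⟩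
  · rintro (w | e) h
    · exact extend_of_ne h.ne
    · rfl
  · intro k hk c
    cases k with
    | none =>
      refine ⟨fun p hp => nodeRel_extend_below (by omega) (hs p hp) c, fun q hq => ?_⟩
      refine nodeRel_congr (fun i' _ => ?_) (hlev q hq c)
      split_ifs with h
      · exact extend_of_ne h.ne
      · rfl
    | some q =>
      exact hlev _ (by rw [Node.len_pre]; exact min_eq_left (some_mem_allowed.1 hk)) c

/-- Any value at one coordinate of a block extends to a tuple of the block. -/
theorem Good.exists_block {z : A → A} {E : Node A n → Set A} (hE : Good R j z E) (hj : 1 ≤ j)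
    {l : ℕ} (hl : j ≤ l) {k : Kind A n} (hk : k ∈ allowed A n j) (c : Coord A n)
    {x : A} (hx : x ∈ E c.sort) :
    ∃ σ, (blockRel R j l k z id σ ∧ ∀ c : Coord A n, σ c ∈ E c.sort) ∧ σ c = x := by
  classical
  have ht : ∀ q w, ∀ x ∈ E w, ∃ t : Node A n → A, (q.len = j → nodeRel R q z id t) ∧
      (∀ w', t w' ∈ E w') ∧ t w = x := by
    intro q w x hx
    by_cases hq : q.len = j
    · obtain ⟨t, h₁, h₂, h₃⟩ := hE.exists_total hj (some_mem_allowed.2 hq.ge) w hx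
      exact ⟨t, fun _ => h₂, h₃, h₁⟩
    · obtain ⟨t, h₁, h₂, h₃⟩ := hE.exists_total hj none_mem_allowed w hx
      exact ⟨t, fun h => absurd h hq, h₃, h₁⟩
  -- Tuples for different words of length `j` are chosen independently, which the private copies
  -- permit.
  have hts : ∀ q₀ w₀, ∀ x ∈ E w₀, ∃ t : Node A n → Node A n → A,
      (∀ q : Node A n, q.len = j → nodeRel R q z id (t q)) ∧ (∀ q w, t q w ∈ E w) ∧
      t q₀ w₀ = x := by
    intro q₀ w₀ x hx
    choose t h₁ h₂ _ using fun q => ht q w₀ x hx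
    exact ⟨t, h₁, h₂, by solve_by_elim⟩
  have hmk : ∀ (s : Node A n → A) (t : Node A n → Node A n → A),
      kindRel R j z (k.map fun q => q.pre l) s → (∀ w, s w ∈ E w) →
      (∀ q : Node A n, q.len = j → nodeRel R q z id (t q)) → (∀ q w, t q w ∈ E w) →
      ∃ σ, (blockRel R j l k z id σ ∧ ∀ c : Coord A n, σ c ∈ E c.sort) ∧
        (∀ w, σ (.inl w) = if k = none ∧ j ≤ w.len then t w w else s w) ∧
        ∀ q w, σ (.inr (q, w)) = t q w := by
    intro s t hs hsE htR htE
    refine ⟨Sum.elim (fun w => if k = none ∧ j ≤ w.len then t w w else s w)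
      fun e => t e.1 e.2, ⟨?_, ?_⟩, fun _ => rfl, fun _ _ => rfl⟩
    · cases k with
      | none =>
        refine ⟨fun p hp => nodeRel_congr (fun i hi => ?_) (hs p hp), fun q hq =>
          nodeRel_congr (fun i hi => ?_) (htR q hq)⟩
        · refine (if_neg fun h => ?_).symm
          have := h.2
          rw [Node.len_pre] at this
          omega
        · by_cases hi' : (q.pre i).len < j
          · simp [hi']
          · have h' : i = j := by rw [Node.len_pre] at hi'; omega
            have hqi : q.pre i = q := Node.pre_of_le (by omega)
            simp [hqi, hq]
      | some q => exact nodeRel_congr (fun i hi => by simp) hs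
    · rintro (w | e)
      · dsimp only [Sum.elim_inl]
        split_ifs
        · exact htE _ _
        · exact hsE _
      · exact htE _ _
  have hk' : (k.map fun q => q.pre l) ∈ allowed A n j := by
    cases k with
    | none => exact none_mem_allowed
    | some q =>
      refine some_mem_allowed.2 ?_
      rw [Node.len_pre]
      exact le_min hl (some_mem_allowed.1 hk)
  rcases c with w | ⟨q, w⟩
  · obtain ⟨s, h₁, h₂, h₃⟩ := hE.exists_total hj hk' w hx
    obtain ⟨t, h₄, h₅, h₆⟩ := hts w w x hx
    obtain ⟨σ, h₇, h₈, -⟩ := hmk s t h₂ h₃ h₄ h₅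
    refine ⟨σ, h₇, ?_⟩
    rw [h₈]
    split_ifs
    · exact h₆
    · exact h₁
  · obtain ⟨s, h₁, h₂, h₃⟩ := hE.exists_total hj hk' w hx
    obtain ⟨t, h₄, h₅, h₆⟩ := hts q w x hx
    obtain ⟨σ, h₇, -, h₈⟩ := hmk s t h₂ h₃ h₄ h₅
    exact ⟨σ, h₇, (h₈ q w).trans h₆⟩

end Blocks

/-! ### Passing from `j` to `j + 1` by gluing copies -/

section PhaseStep
variable {A : Type u} {n : ℕ} {R : Set (Fin (n + 1 + n) → A)} {Γ : ConstraintLanguage A} {j l : ℕ}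
  {E : Node A n → ZUnary A}

/-- The constraints of all blocks of a pattern at level `l`. -/
def patRel (R : Set (Fin (n + 1 + n) → A)) (j l : ℕ) (E : Node A n → ZUnary A)
    (p : Pattern (Kind A n) (Node A n)) : ATup A (p.Block × Coord A n) := fun z α τ =>
  ∀ b, blockRel R j l (p.kind b) z α (fun c => τ (b, c)) ∧
    ∀ c : Coord A n, c.sort.len < j → τ (b, c) ∈ E c.sort z

/-- The equalities of a pattern at level `l`: joints, and private copies in `g` glued to the
nodes they copy. -/
def patEqns (j l : ℕ) (p : Pattern (Kind A n) (Node A n))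
    (g : Finset (p.Block × (Node A n × Node A n))) (τ : p.Block × Coord A n → A) : Prop :=
  p.Agree (joint l) (fun b c => τ (b, c)) ∧
    ∀ e : p.Block × (Node A n × Node A n), e ∈ g → e.2.2.len < j →
      τ (e.1, .inl e.2.2) = τ (e.1, .inr e.2)

def Solves (R : Set (Fin (n + 1 + n) → A)) (j l : ℕ) (E : Node A n → ZUnary A)
    (p : Pattern (Kind A n) (Node A n)) (g : Finset (p.Block × (Node A n × Node A n))) :
    ATup A (p.Block × Coord A n) := fun z α τ => patRel R j l E p z α τ ∧ patEqns j l p g τ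

/-- The projection of the solutions to two coordinates. -/
def solRel (R : Set (Fin (n + 1 + n) → A)) (j l : ℕ) (E : Node A n → ZUnary A)
    (p : Pattern (Kind A n) (Node A n)) (g : Finset (p.Block × (Node A n × Node A n)))
    (a b : p.Block × Coord A n) : ARel A := fun z α c d =>
  ∃ τ, Solves R j l E p g z α τ ∧ τ a = c ∧ τ b = d

/-- The projection of the solutions to one coordinate. -/
def solSet (R : Set (Fin (n + 1 + n) → A)) (j l : ℕ) (E : Node A n → ZUnary A)
    (p : Pattern (Kind A n) (Node A n)) (g : Finset (p.Block × (Node A n × Node A n)))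
    (a : p.Block × Coord A n) : ASet A := fun z α =>
  {d | ∃ τ, Solves R j l E p g z α τ ∧ τ a = d}

/-- Every value of a short coordinate extends to a solution. -/
def Full (R : Set (Fin (n + 1 + n) → A)) (j l : ℕ) (E : Node A n → ZUnary A)
    (p : Pattern (Kind A n) (Node A n)) (g : Finset (p.Block × (Node A n × Node A n))) : Prop :=
  ∀ a : p.Block × Coord A n, a.2.sort.len < j → ∀ z, ∀ d ∈ E a.2.sort z,
    ∃ τ, Solves R j l E p g z id τ ∧ τ a = d

/-- Every value of a short coordinate extends to a solution for constant `α`. -/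
def ConstFull (R : Set (Fin (n + 1 + n) → A)) (j l : ℕ) (E : Node A n → ZUnary A)
    (p : Pattern (Kind A n) (Node A n)) (g : Finset (p.Block × (Node A n × Node A n))) : Prop :=
  ∀ a : p.Block × Coord A n, a.2.sort.len < j → ∀ z, ∀ d ∈ E a.2.sort z, ∀ c,
    ∃ τ, Solves R j l E p g z (fun _ => c) τ ∧ τ a = d

structure PhaseSetup (Γ : ConstraintLanguage A) (R : Set (Fin (n + 1 + n) → A)) (j : ℕ)
    (E : Node A n → ZUnary A) : Prop where
  hasNonempty : HasNonempty Γ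
  mem : ⟨n + 1 + n, R⟩ ∈ Γ
  one_le : 1 ≤ j
  le : j ≤ n
  defn : ∀ w, ZUnary.Def Γ (E w)
  good : ∀ z, Good R j z fun w => E w z

variable {p : Pattern (Kind A n) (Node A n)} {g : Finset (p.Block × (Node A n × Node A n))}

theorem Solves.mono {z α : A → A} {τ : p.Block × Coord A n → A} (h : Solves R j l E p g z id τ) :
    Solves R j l E p g z α τ :=
  ⟨fun b => ⟨blockRel_mono (h.1 b).1, (h.1 b).2⟩, h.2⟩

theorem patEqns_isEquational : IsEquational (patEqns j l p g) := by
  refine .and (p.agree_isEquational fun w => .and (.forall fun _ => .eq _ _)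
    (.forall fun _ => .forall fun _ => .eq _ _)) (.forall fun e => .forall fun _ =>
      .forall fun _ => .eq _ _)

theorem patRel_def [Finite A] (h : PhaseSetup Γ R j E) (l : ℕ)
    (p : Pattern (Kind A n) (Node A n)) : ATup.Def Γ (patRel R j l E p) := fun _ zf αf f =>
  QDef.forall_index h.hasNonempty fun b =>
    (blockRel_def h.hasNonempty h.mem l (p.kind b) zf αf fun c => f (b, c)).and
      (QDef.forall_index h.hasNonempty fun c => QDef.imp h.hasNonempty fun _ =>
        h.defn c.sort zf (f (b, c)))

theorem exists_solves_iff {P : (p.Block × Coord A n → A) → Prop} {z α : A → A} :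
    (∃ τ, Solves R j l E p g z α τ ∧ P τ) ↔
      ∃ h, (patRel R j l E p).quot (patEqns j l p g) z α h ∧ P fun x => h ⟦x⟧ := by
  constructor
  · rintro ⟨τ, ⟨h₁, h₂⟩, h₃⟩
    obtain ⟨h, rfl⟩ := IsEquational.exists_quot h₂
    exact ⟨h, h₁, h₃⟩
  · rintro ⟨h, h₁, h₂⟩
    exact ⟨_, ⟨h₁, patEqns_isEquational.quot h⟩, h₂⟩

theorem solRel_eq (a b : p.Block × Coord A n) : solRel R j l E p g a b =
    ((patRel R j l E p).quot (patEqns j l p g)).pair ⟦a⟧ ⟦b⟧ := by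
  funext z α c d
  exact propext exists_solves_iff

theorem Full.smooth [Finite A] (h : PhaseSetup Γ R j E) (hfull : Full R j l E p g)
    {v : Node A n} (hv : v.len < j) {a b : p.Block × Coord A n} (ha : a.2.sort = v)
    (hb : b.2.sort = v) (hab : ¬ Forced (patEqns j l p g) a b) :
    Smooth Γ (E v) (solRel R j l E p g a b) := by
  have hmem : ∀ z α f, (patRel R j l E p).quot (patEqns j l p g) z α f →
      ∀ a : p.Block × Coord A n, a.2.sort = v → f ⟦a⟧ ∈ E v z := by
    rintro z α f hf a rfl
    exact (hf a.1).2 a.2 hv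
  have hval : ∀ a : p.Block × Coord A n, a.2.sort = v → ∀ z, ∀ d ∈ E v z,
      ∃ f, (patRel R j l E p).quot (patEqns j l p g) z id f ∧ f ⟦a⟧ = d := by
    rintro a rfl z d hd
    exact exists_solves_iff.1 (hfull a hv z d hd)
  rw [solRel_eq]
  refine ATup.pair_smooth ((patRel_def h l p).quot _) (fun z α f hf b => ?_)
    (fun z α f hf => hmem z α f hf a ha) (fun z α f hf => hmem z α f hf b hb)
    (hval a ha) (hval b hb) fun hq => hab (Quotient.exact (s := forcedSetoid _) hq)
  exact ⟨blockRel_mono (hf b).1, (hf b).2⟩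

theorem solSet_def [Finite A] (h : PhaseSetup Γ R j E) (a : p.Block × Coord A n) :
    ASet.Def Γ (solSet R j l E p g a) := by
  classical
  intro X zf αf x
  refine (QDef.exists_pinned (V := Quotient (forcedSetoid (patEqns j l p g)))
    (P := fun s f => (patRel R j l E p).quot (patEqns j l p g) (fun a => s (zf a))
      (fun a => s (αf a)) f)
    ((patRel_def h l p).quot _ (fun a => Sum.inl (zf a)) (fun a => Sum.inl (αf a)) Sum.inr)
    (fun v => if v = ⟦a⟧ then some x else none)).congr fun s => ?_
  refine exists_solves_iff.trans (exists_congr fun f => ?_)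
  simp

/-- Extend every block by the chosen values of level `l + 1`. Since `j ≤ l`, no short coordinate
changes. -/
theorem Solves.relax (hl : j ≤ l) {z : A → A} {τ : p.Block × Coord A n → A}
    (h : Solves R j l E p g z id τ) : ∃ τ', (∀ c, Solves R j (l + 1) E p g z (fun _ => c) τ') ∧
      ∀ a : p.Block × Coord A n, a.2.sort.len < j → τ' a = τ a := by
  have hlow : ∀ b (c : Coord A n), c.sort.len < j →
      extendBlock R z l (fun c => τ (b, c)) c = τ (b, c) := fun b c hc =>
    extendBlock_of_ne (by omega)
  refine ⟨fun a => extendBlock R z l (fun c => τ (a.1, c)) a.2, fun c => ⟨fun b => ⟨?_, ?_⟩, ?_, ?_⟩,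
    fun a ha => hlow a.1 a.2 ha⟩
  · exact blockRel_extendBlock hl (h.1 b).1 c
  · intro c hc
    dsimp only
    rw [hlow b c hc]
    exact (h.1 b).2 c hc
  · exact Pattern.Agree.map (J := joint l) (J' := joint (l + 1)) (f := extendBlock R z l)
      (fun w σ σ' => joint_extendBlock) h.2.1
  · intro e he hej
    dsimp only
    rw [hlow e.1 (.inl e.2.2) hej, hlow e.1 (.inr e.2) hej]
    exact h.2.2 e he hej

/-- At level `j` and constant `α` a single tuple fits blocks of every kind and has copies equal to
originals. Using it everywhere satisfies all joints and gluings. -/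
theorem PhaseSetup.exists_fold (h : PhaseSetup Γ R j E)
    (hp : p.Valid (allowed A n j) (visible (j + 1))) {v : Node A n} (hv : v.len < j) (z : A → A)
    {d : A} (hd : d ∈ E v z) : ∃ τ, (∀ c, Solves R j j E p g z (fun _ => c) τ) ∧
      ∀ a : p.Block × Coord A n, a.2.sort = v → τ a = d := by
  obtain ⟨s, h₁, h₂, h₃⟩ := (h.good z).exists_total h.one_le none_mem_allowed v hd
  obtain ⟨σ, h₄, h₅⟩ := exists_blockRel_const h.one_le h₂
  refine ⟨fun a => σ a.2, fun c => ⟨fun b => ⟨h₅ _ (hp.kind_mem b) c, fun c hc => ?_⟩, ?_, ?_⟩,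
    fun a ha => ?_⟩
  · dsimp only
    rw [h₄ c hc]
    exact h₃ _
  · exact Pattern.agree_const (J := joint j) (σ := σ) (fun w => ⟨fun _ => rfl, fun _ _ => rfl⟩) p
  · intro e _ he
    dsimp only
    rw [h₄ (.inl e.2.2) he, h₄ (.inr e.2) he]
    rfl
  · dsimp only
    rw [h₄ a.2 (ha ▸ hv), ha, h₁]

theorem PhaseSetup.constFull_base (h : PhaseSetup Γ R j E)
    (hp : p.Valid (allowed A n j) (visible (j + 1))) : ConstFull R j j E p g := by
  intro a ha z d hd c
  obtain ⟨τ, h₁, h₂⟩ := h.exists_fold (g := g) hp ha z hd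
  exact ⟨τ, h₁ c, h₂ a rfl⟩

theorem Full.constFull_succ (hl : j ≤ l) (hfull : Full R j l E p g) :
    ConstFull R j (l + 1) E p g := by
  intro a ha z d hd c
  obtain ⟨τ, h₁, rfl⟩ := hfull a ha z d hd
  obtain ⟨τ', h₂, h₃⟩ := h₁.relax hl
  exact ⟨τ', h₂ c, h₃ a ha⟩

theorem PhaseSetup.full_empty (h : PhaseSetup Γ R j E)
    (hp : p.Valid (allowed A n j) (visible (j + 1))) (hl : j ≤ l) : Full R j l E p ∅ := by
  intro a ha z d hd
  obtain ⟨σ, hσ, hσa⟩ := (h.good z).exists_block h.one_le hl (hp.kind_mem a.1) a.2 hd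
  have hstep : ∀ k ∈ allowed A n j, ∀ k' ∈ allowed A n j, ∀ w ∈ visible (j + 1) k,
      w ∈ visible (j + 1) k' → ∀ σ : Coord A n → A,
      (blockRel R j l k z id σ ∧ ∀ c : Coord A n, σ c ∈ E c.sort z) →
      ∃ σ', (blockRel R j l k' z id σ' ∧ ∀ c : Coord A n, σ' c ∈ E c.sort z) ∧ joint l w σ σ' := by
    intro k hk k' hk' w hw hw' σ hσ
    by_cases hwl : w.len ≤ l
    · obtain ⟨σ', h₁, h₂⟩ := (h.good z).exists_block h.one_le hl hk' (.inl w) (hσ.2 (.inl w))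
      exact ⟨σ', h₁, fun _ => h₂.symm, fun h => absurd hwl h.not_ge⟩
    · refine ⟨σ, ⟨?_, hσ.2⟩, fun _ => rfl, fun _ _ => rfl⟩
      cases k with
      | none =>
        have : w.len < j + 1 := hw
        omega
      | some q =>
        cases k' with
        | none =>
          have : w.len < j + 1 := hw'
          omega
        -- A joint deeper than `l` is a common prefix of `q` and `q'`, so both truncate to the same
        -- word at level `l` and the same tuple serves both blocks.
        | some q' =>
          have h₁ : ∀ q : Node A n, w = q.pre w.len → q.pre l = w.pre l := by
            intro q hq
            conv_rhs => rw [hq]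
            rw [Node.pre_pre, min_eq_left (by omega)]
          have h₂ : nodeRel R (q.pre l) z id fun w => σ (.inl w) := hσ.1
          rw [h₁ q hw, ← h₁ q' hw'] at h₂
          exact h₂
  obtain ⟨τ, h₁, h₂, h₃⟩ := Pattern.exists_extend (J := joint l)
    (P := fun k σ => blockRel R j l k z id σ ∧ ∀ c : Coord A n, σ c ∈ E c.sort z)
    (fun w σ σ' h => ⟨fun hw => (h.1 hw).symm, fun hw c => (h.2 hw c).symm⟩)
    hstep hp a.1 σ hσ
  exact ⟨fun x => τ x.1 x.2, ⟨fun b => ⟨(h₁ b).1, fun c _ => (h₁ b).2 c⟩, h₂, by simp⟩,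
    (congrFun h₃ a.2).trans hσa⟩

/-- The levels from `l` down to `j` form the chain: each relation at `id` lies in the next level's
relation for constant `α`, and level `j` is reflexive by folding. -/
theorem PhaseSetup.linked [Finite A] (h : PhaseSetup Γ R j E)
    (hp : p.Valid (allowed A n j) (visible (j + 1))) {v : Node A n} (hv : v.len < j)
    {a b : p.Block × Coord A n} (ha : a.2.sort = v) (hb : b.2.sort = v) :
    ∀ l, j ≤ l → ¬ Forced (patEqns j l p ∅) a b →
      Linked Γ (E v) (solRel R j l E p ∅ a b) := by
  intro l hl
  induction l, hl using Nat.le_induction with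
  | base =>
    intro hab
    refine .refl ((h.full_empty hp le_rfl).smooth h hv ha hb hab) fun z d hd c => ?_
    obtain ⟨τ, h₁, h₂⟩ := h.exists_fold (g := ∅) hp hv z hd
    exact ⟨τ, h₁ c, h₂ a ha, h₂ b hb⟩
  | succ l hl ih =>
    intro hab
    have hS := (h.full_empty hp (hl.trans l.le_succ)).smooth h hv ha hb hab
    have hrelax : ∀ z c d, solRel R j l E p ∅ a b z id c d →
        (solRel R j (l + 1) E p ∅ a b).cst z c d := by
      rintro z _ _ ⟨τ, h₁, rfl, rfl⟩ x
      obtain ⟨τ', h₂, h₃⟩ := h₁.relax hl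
      exact ⟨τ', h₂ x, h₃ a (ha ▸ hv), h₃ b (hb ▸ hv)⟩
    -- Coordinates forced equal at level `l` may separate at `l + 1`, where deep joints impose less.
    -- The chain then ends here, since the lower relation contains the diagonal.
    by_cases hab' : Forced (patEqns j l p ∅) a b
    · refine .refl hS fun z d hd => hrelax z d d ?_
      obtain ⟨τ, h₁, h₂⟩ := h.full_empty hp hl a (ha ▸ hv) z d (ha ▸ hd)
      exact ⟨τ, h₁, h₂, (hab' τ h₁.2).symm.trans h₂⟩
    · exact .step hS (ih hab') hrelax

/-- Minimality of `E` makes some pattern unsolvable over `B`. That pattern at level `n`, with forced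
coordinates identified, is the required witness; its leaves are all classes of coordinates over `v`.
-/
theorem PhaseSetup.critical [Finite A] [Nonempty A] (h : PhaseSetup Γ R j E)
    (hmin : ∀ v : Node A n, v.len < j → ∀ B, ZUnary.Def Γ B → (∀ z, B z ⊆ E v z) →
      (∃ z, B z ≠ E v z) → ∃ z, ¬ ∃ E', Good R j z E' ∧ E' v ⊆ B z ∧
        ∀ w : Node A n, w.len < j → E' w ⊆ E w z)
    {v : Node A n} (hv : v.len < j) : Critical Γ (E v) := by
  classical
  intro B hB hBne hBE hBp
  obtain ⟨z₀, hz₀⟩ := hmin v hv B hB hBE hBp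
  let X : Node A n → Set A := fun w => if w = v then B z₀ else if w.len < j then E w z₀ else Set.univ
  obtain ⟨p, hp', hsat⟩ : ∃ p : Pattern (Kind A n) (Node A n),
      p.Valid (allowed A n j) (visible j) ∧ ¬ ∃ τ, p.Sat (kindRel R j z₀) X τ := by
    by_contra! hcon
    have hX : ∀ w, (X w).Nonempty := fun w => by
      dsimp only [X]
      split_ifs
      · exact hBne z₀
      · exact (h.good z₀).1 w
      · exact Set.univ_nonempty
    obtain ⟨E', h₁, h₂⟩ := exists_consistent hX hcon
    refine hz₀ ⟨E', h₁, (h₂ v).trans_eq (if_pos rfl), fun w hw => (h₂ w).trans ?_⟩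
    dsimp only [X]
    split_ifs with hwv
    · exact hwv ▸ hBE z₀
    · exact subset_rfl
  have hp : p.Valid (allowed A n j) (visible (j + 1)) := by
    refine hp'.mono subset_rfl fun k => ?_
    cases k with
    | none => exact fun w (hw : w.len < j) => Nat.lt_succ_of_lt hw
    | some q => exact subset_rfl
  have hfull : Full R j n E p ∅ := h.full_empty hp h.le
  let G := patEqns j n p ∅
  let ι : Finset (Quotient (forcedSetoid G)) :=
    (Set.toFinite {c | ∃ x : p.Block × Coord A n, x.2.sort = v ∧ ⟦x⟧ = c}).toFinset
  have hι : ∀ c, c ∈ ι ↔ ∃ x : p.Block × Coord A n, x.2.sort = v ∧ ⟦x⟧ = c := fun c => by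
    simp [ι]
  have hval : ∀ a : p.Block × Coord A n, a.2.sort = v → ∀ z, ∀ d ∈ E v z,
      ∃ f, (patRel R j n E p).quot G z id f ∧ f ⟦a⟧ = d := by
    rintro a rfl z d hd
    exact exists_solves_iff.1 (hfull a hv z d hd)
  refine ⟨_, inferInstance, ι, (patRel R j n E p).quot G, (patRel_def h n p).quot G,
    fun z α f hf b => ⟨blockRel_mono (hf b).1, (hf b).2⟩, fun z α f hf c hc => ?_, fun z => ?_,
    fun z c hc d hd => ?_, fun c hc d hd hcd => ?_, z₀, ?_⟩
  · obtain ⟨x, rfl, rfl⟩ := (hι c).1 hc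
    exact (hf x.1).2 x.2 hv
  · obtain ⟨d, hd⟩ := (h.good z).1 v
    exact (hval (p.root, .inl v) rfl z d hd).imp fun f hf => hf.1
  · obtain ⟨x, hx, rfl⟩ := (hι c).1 hc
    exact hval x hx z d hd
  · obtain ⟨x, hx, rfl⟩ := (hι c).1 hc
    obtain ⟨y, hy, rfl⟩ := (hι d).1 hd
    rw [← solRel_eq]
    exact h.linked hp hv hx hy n h.le fun hxy =>
      hcd (Quotient.sound (s := forcedSetoid G) hxy)
  · rintro ⟨f, hf, hfB⟩
    refine hsat ⟨fun b w => f ⟦(b, .inl w)⟧, fun b => ⟨?_, fun w => ?_⟩, ?_⟩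
    · have := (hf b).1
      cases hk : p.kind b with
      | none =>
        rw [hk] at this
        exact this.1
      | some q =>
        rw [hk] at this
        have h' : nodeRel R (q.pre n) z₀ id fun w => f ⟦(b, .inl w)⟧ := this
        rwa [Node.pre_of_le q.len_le] at h'
    · dsimp only [X]
      split_ifs with h₁ h₂
      · subst h₁
        exact hfB _ ((hι _).2 ⟨_, rfl, rfl⟩)
      · exact (hf b).2 (.inl w) h₂
      · trivial
    · have := (patEqns_isEquational (j := j) (l := n) (p := p) (g := ∅)).quot f
      exact this.1.map (J' := fun w (s s' : Node A n → A) => s w = s' w)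
        (f := fun σ w => σ (.inl w)) fun w σ σ' hσ => hσ.1 w.len_le

/-- The values of solutions at a short coordinate form a spreading family, which must fill the
critical domain. -/
theorem PhaseSetup.full_of_constFull [Finite A] [Nonempty A] (h : PhaseSetup Γ R j E)
    (hcrit : ∀ v : Node A n, v.len < j → Critical Γ (E v)) (hIV : ¬ QDefinesMightyTupleIV Γ)
    (hc : ConstFull R j l E p g) (hne : ∀ z, ∃ τ, Solves R j l E p g z id τ) :
    Full R j l E p g := by
  intro a ha z d hd
  refine (hcrit _ ha).full h.hasNonempty hIV (h.defn _) (X := solSet R j l E p g a)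
    ⟨solSet_def h a, ?_, ?_, ?_, ?_⟩ z hd
  · rintro z α _ ⟨τ, h₁, rfl⟩
    exact ⟨τ, h₁.mono, rfl⟩
  · rintro z α _ ⟨τ, h₁, rfl⟩
    exact (h₁.1 a.1).2 a.2 ha
  · intro z
    obtain ⟨τ, hτ⟩ := hne z
    exact ⟨_, τ, hτ, rfl⟩
  · exact fun z x d hd => hc a ha z d hd x

/-- Glue one copy at a time, and for each gluing climb the levels: fullness at `l` gives fullness
for constant `α` at `l + 1`; this makes `Q^∀` reflexive for the pair being glued, and a loop of
`Q^∀∀` solves the glued pattern. -/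
theorem PhaseSetup.full [Finite A] [Nonempty A] (h : PhaseSetup Γ R j E)
    (hcrit : ∀ v : Node A n, v.len < j → Critical Γ (E v)) (hIV : ¬ QDefinesMightyTupleIV Γ)
    (hV : ¬ QDefinesMightyTupleV Γ) (hp : p.Valid (allowed A n j) (visible (j + 1)))
    (g : Finset (p.Block × (Node A n × Node A n))) : ∀ l, j ≤ l → Full R j l E p g := by
  classical
  induction g using Finset.induction_on with
  | empty => exact fun l hl => h.full_empty hp hl
  | insert e g _ ih =>
    have hsub : ∀ {l z α τ}, Solves R j l E p (insert e g) z α τ → Solves R j l E p g z α τ :=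
      fun hτ => ⟨hτ.1, hτ.2.1, fun e' he' => hτ.2.2 e' (Finset.mem_insert_of_mem he')⟩
    have hadd : ∀ {l z α τ}, Solves R j l E p g z α τ →
        (e.2.2.len < j → τ (e.1, .inl e.2.2) = τ (e.1, .inr e.2)) →
        Solves R j l E p (insert e g) z α τ := fun hτ he =>
      ⟨hτ.1, hτ.2.1, fun e' he' => (Finset.mem_insert.1 he').elim (fun h => h ▸ he)
        (hτ.2.2 e')⟩
    have hstep : ∀ l, j ≤ l → ConstFull R j l E p (insert e g) →
        Full R j l E p (insert e g) := by
      intro l hl hc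
      refine h.full_of_constFull hcrit hIV hc fun z => ?_
      have hex : ∃ τ, Solves R j l E p g z id τ := by
        obtain ⟨d, hd⟩ := (h.good z).1 Node.nil
        exact (ih l hl (p.root, .inl Node.nil) h.one_le z d hd).imp fun τ hτ => hτ.1
      by_cases he : e.2.2.len < j
      · by_cases hf : Forced (patEqns j l p g) (e.1, .inl e.2.2) (e.1, .inr e.2)
        · obtain ⟨τ, hτ⟩ := hex
          exact ⟨τ, hadd hτ fun _ => hf τ hτ.2⟩
        · have hS := (ih l hl).smooth h he (a := (e.1, .inl e.2.2)) (b := (e.1, .inr e.2)) rfl rfl hf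
          obtain ⟨d, τ, h₁, h₂, h₃⟩ := exists_loop_of_not_mightyTupleV hV (h.defn _)
            (fun z => (h.good z).1 _) hS (fun z d hd x => by
              obtain ⟨τ, h₁, h₂⟩ := hc (e.1, .inl e.2.2) he z d hd x
              exact ⟨τ, hsub h₁, h₂, (h₁.2.2 e (Finset.mem_insert_self _ _) he).symm.trans h₂⟩) z
          exact ⟨τ, hadd h₁ fun _ => h₂.trans h₃.symm⟩
      · obtain ⟨τ, hτ⟩ := hex
        exact ⟨τ, hadd hτ fun h => absurd h he⟩
    intro l hl
    induction l, hl using Nat.le_induction with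
    | base => exact hstep j le_rfl (h.constFull_base hp)
    | succ l hl ihl => exact hstep (l + 1) (hl.trans l.le_succ) (ihl.constFull_succ hl)

theorem good_succ [Finite A] [Nonempty A] (hΓ : HasNonempty Γ) (hR : ⟨n + 1 + n, R⟩ ∈ Γ)
    (hj : 1 ≤ j) (hjn : j ≤ n) (hIV : ¬ QDefinesMightyTupleIV Γ)
    (hV : ¬ QDefinesMightyTupleV Γ) (hgood : ∀ z, ∃ E, Good R j z E) (z : A → A) :
    ∃ E, Good R (j + 1) z E := by
  classical
  obtain ⟨E, hE, hEgood, hmin⟩ := exists_minimal_good hΓ hR hgood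
  have h : PhaseSetup Γ R j E := ⟨hΓ, hR, hj, hjn, hE, hEgood⟩
  suffices hsat : ∀ p : Pattern (Kind A n) (Node A n),
      p.Valid (allowed A n (j + 1)) (visible (j + 1)) →
      ∃ τ, p.Sat (kindRel R (j + 1) z) (fun _ => Set.univ) τ by
    obtain ⟨E', h', -⟩ := exists_consistent (fun _ => Set.univ_nonempty) hsat
    exact ⟨E', h'⟩
  intro p hp'
  have hp : p.Valid (allowed A n j) (visible (j + 1)) :=
    hp'.mono (fun k (hk : k ∈ allowed A n (j + 1)) q hq => (Nat.le_succ j).trans (hk q hq))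
      fun _ => subset_rfl
  have := Fintype.ofFinite (p.Block × (Node A n × Node A n))
  obtain ⟨d, hd⟩ := (hEgood z).1 Node.nil
  -- With every copy glued at level `n`, each merged block satisfies all constraints at words of
  -- length at most `j` on common variables.
  obtain ⟨τ, ⟨h₁, h₂, h₃⟩, -⟩ := h.full (fun v => h.critical hmin) hIV hV hp Finset.univ n hjn
    (p.root, .inl Node.nil) hj z d hd
  refine ⟨fun b w => τ (b, .inl w), fun b => ⟨?_, fun _ => trivial⟩, ?_⟩
  · have := (h₁ b).1
    cases hk : p.kind b with
    | none =>
      rw [hk] at this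
      intro q hq
      rcases Nat.lt_succ_iff_lt_or_eq.1 hq with hq | hq
      · exact this.1 q hq
      · refine nodeRel_congr (fun i _ => ?_) (this.2 q hq)
        split_ifs with hi
        · exact (h₃ (b, q, q.pre i) (Finset.mem_univ _) hi).symm
        · rfl
    | some q =>
      rw [hk] at this
      have h' : nodeRel R (q.pre n) z id fun w => τ (b, .inl w) := this
      rwa [Node.pre_of_le q.len_le] at h'
  · exact h₂.map (J' := fun w (s s' : Node A n → A) => s w = s' w)
      (f := fun σ w => σ (.inl w)) fun w σ σ' hσ => hσ.1 w.len_le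

end PhaseStep
end QCSP

/-! ### The main theorem -/

theorem mainTheorem8 {A : Type*} [Finite A] {n : ℕ} (R : Set (Fin (n + 1 + n) → A))
    (hR : ∃ D : QCSP.ZReduction A (QCSP.YVar A n),
      D.IsNonempty ∧ D.IsOneConsistent (QCSP.inducedInstance R)) :
    (∀ z : A → A, ∃ s : QCSP.YVar A n → A, (QCSP.inducedInstance R).IsSolution z s) ∨
      (QCSP.QDefinesMightyTupleIV {⟨n + 1 + n, R⟩} ∨
        QCSP.QDefinesMightyTupleV {⟨n + 1 + n, R⟩}) := by
  open QCSP in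
  obtain ⟨D, hne, hcons⟩ := hR
  have : Nonempty A := ⟨(hne Node.nil.toVar id).some⟩
  by_contra! hcon
  obtain ⟨⟨z, hz⟩, hIV, hV⟩ := hcon
  have hgood := good_one_of_oneConsistent hne hcons
  -- Consistency at the root constraint exhibits a tuple of `R`.
  have hΓ : HasNonempty ({⟨n + 1 + n, R⟩} : ConstraintLanguage A) := by
    obtain ⟨E, hE⟩ := hgood id
    obtain ⟨x, hx⟩ := hE.1 Node.nil
    obtain ⟨s, -, hs, -⟩ := hE.exists_total le_rfl none_mem_allowed Node.nil hx
    obtain ⟨β, hβ⟩ := hs Node.nil Nat.one_pos x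
    obtain ⟨y, hy⟩ := hβ x
    exact ⟨_, R, rfl, _, hy⟩
  have key : ∀ j, 1 ≤ j → j ≤ n + 1 → ∀ z, ∃ E, Good R j z E := by
    intro j hj
    induction j, hj using Nat.le_induction with
    | base => exact fun _ => hgood
    | succ j hj ih =>
      exact fun hjn => good_succ hΓ rfl hj (by omega) hIV hV (ih (by omega))
  obtain ⟨E, hE⟩ := key (n + 1) (by omega) le_rfl z
  obtain ⟨s, hs⟩ := exists_isSolution_of_good hE
  exact hz s hs
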